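/- For integers $m, n \ge 1$, a $(1,2)$-QCNF formula with $m$ universal and $n$ existential variables is a quantified Boolean formula $$F=\forall x_1\cdots\forall x_m\,\exists y_1\cdots\exists y_n\ \varphi(x_1,\dots,x_m,y_1,\dots,y_n),$$ where $\varphi$ is a conjunction of clauses, each of which is a disjunction of exactly one universal literal ($x_i$ or $\neg x_i$) and two existential literals ($y_j$ or $\neg y_j$) on two different existential variables; so there are $N=4mn(n-1)$ possible clauses. $F$ is true if for every assignment to $x_1,\dots,x_m$ there is an assignment to $y_1,\dots,y_n$ under which all clauses are true. For $c>0$, let $\mathbb{P}_{m,c}(n)$ be the probability that $F$ is true when each of the $N$ possible clauses is included in $F$ independently with probability $p=\frac{c}{4mn}$ (which is less than $1$ as soon as $4mn>c$). Let $c>0$ be fixed and let $m=m(n)$ be any sequence of nonnegative integers with $m(n)\ge 1$ for all sufficiently large $n$. - If $c<1$, then $\mathbb{P}_{m(n),c}(n)\to 1$ as $n\to\infty$. - If $c>2$, then $\mathbb{P}_{m(n),c}(n)\to 0$ as $n\to\infty$. -/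

import Mathlib

namespace OneTwoQCNF

/-- A literal over `k` propositional variables: `(i, true)` is the `i`-th variable and
`(i, false)` is its negation. The atom of a literal is its first component. -/
abbrev Literal (k : ℕ) : Type := Fin k × Bool

/-- The literal `l` is true under the truth assignment `I`. -/
def Literal.Holds {k : ℕ} (l : Literal k) (I : Fin k → Bool) : Prop := I l.1 = l.2

/-- A 2-clause over `n` variables, as a set of literals: exactly two literals, which are strictly
distinct, i.e. have different atoms. -/
abbrev TwoClause (n : ℕ) : Type :=
  {s : Finset (Literal n) // s.card = 2 ∧ Set.InjOn Prod.fst (s : Set (Literal n))}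

/-- A clause over `m` universal and `n` existential variables: the disjunction of one universal
literal and two strictly distinct existential literals. There are `4 * m * n * (n - 1)` of them. -/
abbrev Clause (m n : ℕ) : Type := Literal m × TwoClause n

/-- The clause `C` is true when the universal variables are assigned by `I` and the existential
variables by `J`. -/
def Clause.Holds {m n : ℕ} (C : Clause m n) (I : Fin m → Bool) (J : Fin n → Bool) : Prop :=
  C.1.Holds I ∨ ∃ l ∈ C.2.1, l.Holds J

/-- The formula `∀ X ∃ Y φ(X, Y)` with `m` universal and `n` existential variables, given by the
set of the clauses of `φ`. -/
abbrev Formula (m n : ℕ) : Type := Set (Clause m n)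

/-- The formula is true: each assignment to the universal variables can be completed by an
assignment to the existential variables that makes all clauses true. -/
def Formula.IsTrue {m n : ℕ} (F : Formula m n) : Prop :=
  ∀ I : Fin m → Bool, ∃ J : Fin n → Bool, ∀ C ∈ F, C.Holds I J

/-- The clause probability `c / (4 m n)`. It is a number of `[0, 1]` as soon as
`0 ≤ c ≤ 4 m n` and is truncated to `[0, 1]` otherwise (for given `c`, and `m ≥ 1`, this concerns
only finitely many `n`). -/
noncomputable def clauseProb (c : ℝ) (m n : ℕ) : unitInterval :=
  Set.projIcc (0 : ℝ) 1 zero_le_one (c / (4 * (m : ℝ) * (n : ℝ)))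

/-- The law of the random formula that contains each of the possible clauses with probability
`c / (4 m n)`, independently of the others. -/
noncomputable def randomFormula (c : ℝ) (m n : ℕ) : MeasureTheory.Measure (Formula m n) :=
  ProbabilityTheory.setBernoulli Set.univ (clauseProb c m n)

/-- The probability that the random formula is true. -/
noncomputable def probTrue (c : ℝ) (m n : ℕ) : ℝ :=
  (randomFormula c m n).real {F : Formula m n | F.IsTrue}

end OneTwoQCNF

/-! Both halves compare the formula with a random 2-CNF over the existential variables. If the
2-clauses that occur with any of the 2m universal literals are jointly satisfiable, one assignment
of the y's serves every assignment of the x's. Conversely, if the formula is true, setting all x's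
to true shows that the 2-clauses occurring with some negated x are jointly satisfiable. In either
set the 2-clauses occur independently, with probability at most c/(2n) in the first and about c/(4n)
in the second, whatever m is. Random 2-SAT has its threshold at 1/(2n), whence the conditions c < 1
and c > 2.

Case c < 1, first moment: an unsatisfiable 2-CNF contains a bicycle (`exists_isBicycle`), and the
expected number of bicycles is at most the sum over s of (2n)^s * 2s^2 * (c/(2n))^(s+1), which is
O(1/n).

Case c > 2, second moment: a snake is an unsatisfiable set of 2(k+1) clauses, here with k about
n^(1/8). If q is the probability of a 2-clause, two snakes A and B occur together with probability
q^|A ∪ B|. For fixed A, the sum over B is bounded by letting B range over pairs of arbitrary walks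
between the two literals of a hub, whose steps are weighted by the matrix J + q⁻¹ M. Here J is the
all-ones matrix and M counts the implications of A. Walks along A branch only at its hub, once in
k+1 steps, so M has growth rate at most 1 + 1/(k+1) (`Snake.isPotential`). As 2nq eventually exceeds
a constant above 1, the term q⁻¹ M grows strictly slower than J, whose growth rate is 2n. Overlaps
are then negligible (`IsPotential.entry_le`, `Snake.sum_pow_card_union_le`), and Chebyshev's
inequality yields a snake with high probability. -/

open MeasureTheory ProbabilityTheory

namespace OneTwoQCNF

open scoped Classical

/-! ### Reduction to 2-CNF formulas -/

/-- The negation of a literal. -/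
def Literal.neg {k : ℕ} (l : Literal k) : Literal k := (l.1, !l.2)

/-- A set of literals that is a 2-clause. -/
def IsTwoClause {n : ℕ} (s : Finset (Literal n)) : Prop :=
  s.card = 2 ∧ Set.InjOn Prod.fst (s : Set (Literal n))

/-- Satisfiability of a propositional formula in conjunctive normal form. -/
def Satisfiable {n : ℕ} (G : Set (Finset (Literal n))) : Prop :=
  ∃ J : Fin n → Bool, ∀ s ∈ G, ∃ l ∈ s, l.Holds J

/-- The 2-clauses that occur in `F` together with a universal literal from `Λ`. -/
def Formula.proj {m n : ℕ} (Λ : Finset (Literal m)) (F : Formula m n) :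
    Set (Finset (Literal n)) :=
  {s | ∃ l ∈ Λ, ∃ D : TwoClause n, D.1 = s ∧ (l, D) ∈ F}

lemma Formula.isTwoClause_of_mem_proj {m n : ℕ} {Λ : Finset (Literal m)} {F : Formula m n}
    {s : Finset (Literal n)} (h : s ∈ F.proj Λ) : IsTwoClause s := by
  obtain ⟨l, -, D, rfl, -⟩ := h
  exact D.2

lemma Formula.isTrue_of_satisfiable {m n : ℕ} {F : Formula m n}
    (h : Satisfiable (F.proj Finset.univ)) : F.IsTrue := by
  obtain ⟨J, hJ⟩ := h
  exact fun I => ⟨J, fun C hC => Or.inr (hJ _ ⟨C.1, Finset.mem_univ _, C.2, rfl, hC⟩)⟩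

/-- Under the all-true assignment of the universal variables, a clause with a negated universal
literal must be satisfied by its existential part. -/
lemma Formula.satisfiable_of_isTrue {m n : ℕ} {F : Formula m n} (h : F.IsTrue) :
    Satisfiable (F.proj (Finset.univ ×ˢ {false})) := by
  obtain ⟨J, hJ⟩ := h fun _ => true
  refine ⟨J, ?_⟩
  rintro s ⟨l, hl, D, rfl, hD⟩
  rcases hJ _ hD with h | h
  · rw [Finset.mem_product, Finset.mem_singleton] at hl
    simp [Literal.Holds, hl.2] at h
  · exact h

/-! ### Law of the projected 2-CNF -/

instance (ι : Type*) [Finite ι] : DiscreteMeasurableSpace (Set ι) :=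
  have : MeasurableSingletonClass (Set ι) := inferInstanceAs (MeasurableSingletonClass (ι → Prop))
  inferInstance

lemma setBernoulli_real_forall_notMem {ι : Type*} [Finite ι] (p : unitInterval) (K : Finset ι) :
    (setBernoulli Set.univ p).real {F : Set ι | ∀ C ∈ K, C ∉ F} = (1 - (p : ℝ)) ^ K.card := by
  have : (setBernoulli Set.univ p) {F : Set ι | ∀ C ∈ K, C ∉ F}
      = (unitInterval.toNNReal (unitInterval.symm p) : ENNReal) ^ K.card := by
    rw [setBernoulli_apply']
    have : ((fun p : ι → Prop ↦ {i | p i}) ⁻¹' {F : Set ι | ∀ C ∈ K, C ∉ F})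
        = Set.pi K (fun _ => {False}) := by
      ext f; simp [Set.mem_pi]
    rw [this, Measure.infinitePi_pi]
    · simp
    · intros; exact .of_discrete
  rw [measureReal_def, this]
  simp

instance (c : ℝ) (m n : ℕ) : IsProbabilityMeasure (randomFormula c m n) := by
  unfold randomFormula; infer_instance

/-- The probability that a given 2-clause occurs with some universal literal from a set of
cardinality `r`. -/
noncomputable def projProb (c : ℝ) (m n r : ℕ) : ℝ := 1 - (1 - (clauseProb c m n : ℝ)) ^ r

/-- Absence of the 2-clauses in `Z` means absence of the clauses in `Λ ×ˢ Z`, a product event.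
Presence is reduced to absence by induction on `A`: P(D present) = P(no condition on D) - P(D
absent). The set `Z` is carried along for this recursion. -/
lemma randomFormula_real_proj_aux (c : ℝ) (m n : ℕ) (Λ : Finset (Literal m))
    (A : Finset (TwoClause n)) : ∀ Z : Finset (TwoClause n), Disjoint A Z →
    (randomFormula c m n).real
      {F | (∀ D ∈ A, D.1 ∈ F.proj Λ) ∧ ∀ D ∈ Z, D.1 ∉ F.proj Λ} =
      projProb c m n Λ.card ^ A.card * (1 - projProb c m n Λ.card) ^ Z.card := by
  induction A using Finset.induction_on with
  | empty =>
    intro Z _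
    have : {F : Formula m n | (∀ D ∈ (∅ : Finset (TwoClause n)), D.1 ∈ F.proj Λ) ∧
        ∀ D ∈ Z, D.1 ∉ F.proj Λ} = {F | ∀ C ∈ Λ ×ˢ Z, C ∉ F} := by
      ext F
      simp only [Formula.proj, Finset.notMem_empty, Set.mem_ofPred_eq]
      constructor
      · rintro ⟨-, h⟩ ⟨l, D⟩ hC hF
        rw [Finset.mem_product] at hC
        exact h D hC.2 ⟨l, hC.1, D, rfl, hF⟩
      · refine fun h => ⟨by simp, ?_⟩
        rintro D hD ⟨l, hl, D', h', hF⟩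
        obtain rfl := Subtype.ext h'
        exact h (l, D') (Finset.mem_product.2 ⟨hl, hD⟩) hF
    rw [this, randomFormula, setBernoulli_real_forall_notMem, Finset.card_product, pow_mul]
    simp [projProb]
  | insert D A hD ih =>
    intro Z hZ
    rw [Finset.disjoint_insert_left] at hZ
    have h1 := ih Z hZ.2
    have h2 := ih (insert D Z) (by rw [Finset.disjoint_insert_right]; exact ⟨hD, hZ.2⟩)
    have h3 := measureReal_inter_add_sdiff (μ := randomFormula c m n)
      (s := {F : Formula m n | (∀ D ∈ A, D.1 ∈ F.proj Λ) ∧ ∀ D ∈ Z, D.1 ∉ F.proj Λ})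
      (t := {F : Formula m n | D.1 ∈ F.proj Λ}) .of_discrete
    have e1 : {F : Formula m n | (∀ D ∈ A, D.1 ∈ F.proj Λ) ∧ ∀ D ∈ Z, D.1 ∉ F.proj Λ} ∩
        {F | D.1 ∈ F.proj Λ} = {F | (∀ D' ∈ insert D A, D'.1 ∈ F.proj Λ) ∧
          ∀ D ∈ Z, D.1 ∉ F.proj Λ} := by
      ext F
      simp only [Finset.forall_mem_insert, Set.mem_inter_iff, Set.mem_ofPred_eq]
      tauto
    have e2 : {F : Formula m n | (∀ D ∈ A, D.1 ∈ F.proj Λ) ∧ ∀ D ∈ Z, D.1 ∉ F.proj Λ} \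
        {F | D.1 ∈ F.proj Λ} = {F | (∀ D' ∈ A, D'.1 ∈ F.proj Λ) ∧
          ∀ D' ∈ insert D Z, D'.1 ∉ F.proj Λ} := by
      ext F
      simp only [Finset.forall_mem_insert, Set.mem_sdiff, Set.mem_ofPred_eq]
      tauto
    rw [e1, e2, h1, h2, Finset.card_insert_of_notMem hZ.1] at h3
    rw [Finset.card_insert_of_notMem hD]
    linear_combination h3

lemma randomFormula_real_proj (c : ℝ) (m n : ℕ) (Λ : Finset (Literal m))
    (A : Finset (Finset (Literal n))) (hA : ∀ s ∈ A, IsTwoClause s) :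
    (randomFormula c m n).real {F | ∀ s ∈ A, s ∈ F.proj Λ} = projProb c m n Λ.card ^ A.card := by
  have h := randomFormula_real_proj_aux c m n Λ
    (A.subtype fun s : Finset (Literal n) => s.card = 2 ∧ Set.InjOn Prod.fst (s : Set (Literal n))) ∅ (by simp)
  have e : (A.subtype fun s : Finset (Literal n) => s.card = 2 ∧ Set.InjOn Prod.fst (s : Set (Literal n))).card
      = A.card := by
    rw [Finset.card_subtype, Finset.filter_true_of_mem]
    exact hA
  rw [e] at h
  simp only [Finset.card_empty, pow_zero, mul_one] at h
  rw [← h]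
  congr 1
  ext F
  simp only [Set.mem_ofPred_eq, Finset.mem_subtype, Finset.notMem_empty]
  constructor
  · exact fun H => ⟨fun D hD => H _ hD, by simp⟩
  · exact fun H s hs => H.1 ⟨s, hA s hs⟩ hs

/-! ### Second moment method -/

/-- The second moment method. -/
lemma measureReal_forall_notMem_le {Ω ι : Type*} [MeasurableSpace Ω] [Finite Ω]
    [DiscreteMeasurableSpace Ω] [Fintype ι] (μ : Measure Ω) [IsProbabilityMeasure μ]
    (E : ι → Set Ω) (ε : ℝ) (h0 : 0 < ∑ i, μ.real (E i))
    (h : ∑ i, ∑ j, μ.real (E i ∩ E j) ≤ (1 + ε) * (∑ i, μ.real (E i)) ^ 2) :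
    μ.real {ω | ∀ i, ω ∉ E i} ≤ ε := by
  set a := ∑ i, μ.real (E i) with ha
  let X : Ω → ℝ := fun ω => ∑ i, (E i).indicator 1 ω
  have hint (f : Ω → ℝ) : Integrable f μ := Integrable.of_finite
  have hX : ∫ ω, X ω ∂μ = a := by
    rw [integral_finsetSum _ fun i _ => hint _]
    exact Finset.sum_congr rfl fun i _ => integral_indicator_one .of_discrete
  have hX2 : ∫ ω, X ω ^ 2 ∂μ = ∑ i, ∑ j, μ.real (E i ∩ E j) := by
    have : ∀ ω, X ω ^ 2 = ∑ i, ∑ j, (E i ∩ E j).indicator 1 ω := by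
      intro ω
      rw [sq, Finset.sum_mul_sum]
      refine Finset.sum_congr rfl fun i _ => Finset.sum_congr rfl fun j _ => ?_
      rw [Set.inter_indicator_one, Pi.mul_apply]
    simp_rw [this]
    rw [integral_finsetSum _ fun i _ => hint _]
    refine Finset.sum_congr rfl fun i _ => ?_
    rw [integral_finsetSum _ fun i _ => hint _]
    exact Finset.sum_congr rfl fun i _ => integral_indicator_one .of_discrete
  -- Chebyshev: where no `E i` occurs, `X` vanishes and the squared deviation equals `a ^ 2`.
  have key : a ^ 2 * μ.real {ω | ∀ i, ω ∉ E i} ≤ ∫ ω, (X ω - a) ^ 2 ∂μ := by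
    rw [← integral_indicator_one (μ := μ) (s := {ω | ∀ i, ω ∉ E i}) .of_discrete,
      ← integral_const_mul]
    refine integral_mono (hint _) (hint _) fun ω => ?_
    by_cases hω : ω ∈ {ω | ∀ i, ω ∉ E i}
    · have : X ω = 0 := Finset.sum_eq_zero fun i _ => Set.indicator_of_notMem (hω i) _
      simp [Set.indicator_of_mem hω, this]
    · simp only [Set.indicator_of_notMem hω, mul_zero]
      positivity
  have hv : ∫ ω, (X ω - a) ^ 2 ∂μ = ∫ ω, X ω ^ 2 ∂μ - a ^ 2 := by
    have : ∀ ω, (X ω - a) ^ 2 = X ω ^ 2 - (2 * a * X ω - a ^ 2) := fun ω => by ring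
    simp_rw [this]
    rw [integral_sub (hint _) (hint _), integral_sub (hint _) (hint _), integral_const_mul, hX]
    simp
    ring
  rw [hv, hX2] at key
  have : a ^ 2 * μ.real {ω | ∀ i, ω ∉ E i} ≤ a ^ 2 * ε := by linarith
  exact le_of_mul_le_mul_left this (by positivity)

/-! ### Implications and satisfiability of 2-CNF formulas -/

namespace Literal
variable {n : ℕ}

@[simp] lemma neg_neg (u : Literal n) : u.neg.neg = u := by simp [neg]

@[simp] lemma neg_fst (u : Literal n) : u.neg.1 = u.1 := rfl

lemma neg_ne_self (u : Literal n) : u.neg ≠ u := fun h => by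
  have := congrArg Prod.snd h
  simp [neg] at this

lemma neg_inj {u v : Literal n} : u.neg = v.neg ↔ u = v :=
  ⟨fun h => by simpa using congrArg neg h, fun h => h ▸ rfl⟩

lemma neg_eq_iff {u v : Literal n} : u.neg = v ↔ u = v.neg :=
  ⟨fun h => by simp [← h], fun h => by simp [h]⟩

lemma eq_or_eq_neg {u v : Literal n} (h : u.1 = v.1) : u = v ∨ u = v.neg := by
  obtain ⟨a, b⟩ := u
  obtain ⟨a', b'⟩ := v
  obtain rfl : a = a' := h
  cases b <;> cases b' <;> simp [neg]

/-- The clause expressing the implication from `u` to `v`. -/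
def imp (u v : Literal n) : Finset (Literal n) := {u.neg, v}

lemma imp_contrapose (u v : Literal n) : imp v.neg u.neg = imp u v := by
  simp [imp, Finset.pair_comm]

lemma mem_imp {u v w : Literal n} : w ∈ imp u v ↔ w = u.neg ∨ w = v := by
  simp [imp]

end Literal

open Literal

variable {n : ℕ}

/-- The implication relation of a set of 2-clauses. -/
def Implies (G : Set (Finset (Literal n))) (u v : Literal n) : Prop := imp u v ∈ G

lemma Implies.contrapose {G : Set (Finset (Literal n))} {u v : Literal n}
    (h : Relation.ReflTransGen (Implies G) u v) :
    Relation.ReflTransGen (Implies G) v.neg u.neg := by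
  induction h with
  | refl => exact .refl
  | tail _ h ih =>
    refine .head ?_ ih
    unfold Implies at *
    rwa [imp_contrapose]

/-- A set of 2-clauses is satisfiable unless some literal and its negation imply each other. -/
lemma satisfiable_of_forall_not_implies {G : Set (Finset (Literal n))}
    (hG : ∀ s ∈ G, IsTwoClause s)
    (h : ∀ z, Relation.ReflTransGen (Implies G) z z.neg →
      ¬ Relation.ReflTransGen (Implies G) z.neg z) : Satisfiable G := by
  -- A maximal consistent set of literals closed under implication turns out to decide every atom,
  -- and so defines a satisfying assignment.
  obtain ⟨S, hS⟩ := (Set.toFinite {S : Set (Literal n) |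
    (∀ u ∈ S, ∀ v, Implies G u v → v ∈ S) ∧ ∀ u ∈ S, u.neg ∉ S}).exists_maximal ⟨∅, by simp⟩
  obtain ⟨hcl, hco⟩ := hS.prop
  have hcl' : ∀ u v, u ∈ S → Relation.ReflTransGen (Implies G) u v → v ∈ S := by
    intro u v hu huv
    induction huv with
    | refl => exact hu
    | tail _ h ih => exact hcl _ ih _ h
  have key : ∀ u, ¬ Relation.ReflTransGen (Implies G) u u.neg → u ∈ S ∨ u.neg ∈ S := by
    intro u hu
    by_contra! hcon
    -- Adding all consequences of `u` keeps the set closed. By contraposition, an inconsistency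
    -- would put `u.neg` into `S` or give an implication from `u` to `u.neg`.
    refine hcon.1 (hS.le_of_ge (y := S ∪ {v | Relation.ReflTransGen (Implies G) u v}) ⟨?_, ?_⟩
      Set.subset_union_left (Or.inr .refl))
    · rintro v (hv | hv) w hvw
      · exact Or.inl (hcl _ hv _ hvw)
      · exact Or.inr (hv.tail hvw)
    · rintro v (hv | hv) (hv' | hv')
      · exact hco v hv hv'
      · exact hcon.2 (hcl' _ _ hv (by simpa using Implies.contrapose hv'))
      · exact hcon.2 (hcl' _ _ hv' (Implies.contrapose hv))
      · exact hu (hv.trans (by simpa using Implies.contrapose hv'))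
  have htot : ∀ u, u ∈ S ∨ u.neg ∈ S := by
    intro u
    by_cases hu : Relation.ReflTransGen (Implies G) u u.neg
    · have := key u.neg (by simpa using h u hu)
      rw [neg_neg] at this
      exact this.symm
    · exact key u hu
  refine ⟨fun x => decide ((x, true) ∈ S), fun s hs => ?_⟩
  have holds : ∀ l ∈ S, Literal.Holds l (fun x => decide ((x, true) ∈ S)) := by
    rintro ⟨x, b⟩ hl
    cases b
    · simpa [Holds, Literal.neg] using hco _ hl
    · simpa [Holds] using hl
  obtain ⟨a, b, -, rfl⟩ := Finset.card_eq_two.1 (hG s hs).1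
  rcases htot a with ha | ha
  · exact ⟨a, by simp, holds a ha⟩
  · exact ⟨b, by simp, holds b (hcl _ ha _ (by simpa [Implies, imp] using hs))⟩

/-! ### Walks and bicycles -/

/-- There is a walk of length `k` from `a` to `b` along the relation `r`. -/
def HasWalk {α : Type*} (r : α → α → Prop) (k : ℕ) (a b : α) : Prop :=
  ∃ p : ℕ → α, p 0 = a ∧ p k = b ∧ ∀ i < k, r (p i) (p (i + 1))

lemma exists_concat_walk {α : Type*} {r : α → α → Prop} {k l : ℕ} {a b c : α}
    (h : HasWalk r k a b) (h' : HasWalk r l b c) :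
    ∃ p : ℕ → α, p 0 = a ∧ p k = b ∧ p (k + l) = c ∧ ∀ i < k + l, r (p i) (p (i + 1)) := by
  obtain ⟨p, rfl, rfl, hp⟩ := h
  obtain ⟨p', h0, rfl, hp'⟩ := h'
  refine ⟨fun i => if i ≤ k then p i else p' (i - k), by simp, by simp, ?_, ?_⟩
  · by_cases hl : l = 0
    · simp [hl, h0]
    · simp [hl]
  · intro i hi
    rcases lt_trichotomy i k with h | h | h
    · simpa [h.le, Nat.succ_le_of_lt h] using hp i h
    · subst h
      simpa [h0] using hp' 0 (by omega)
    · have := hp' (i - k) (by omega)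
      rw [show i - k + 1 = i + 1 - k by omega] at this
      simpa [show ¬ i ≤ k by omega, show ¬ i + 1 ≤ k by omega] using this

lemma HasWalk.trans {α : Type*} {r : α → α → Prop} {k l : ℕ} {a b c : α}
    (h : HasWalk r k a b) (h' : HasWalk r l b c) : HasWalk r (k + l) a c := by
  obtain ⟨p, h0, -, h2, h3⟩ := exists_concat_walk h h'
  exact ⟨p, h0, h2, h3⟩

lemma hasWalk_segment {α : Type*} {r : α → α → Prop} {p : ℕ → α} {k i j : ℕ}
    (hp : ∀ i < k, r (p i) (p (i + 1))) (hij : i ≤ j) (hj : j ≤ k) :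
    HasWalk r (j - i) (p i) (p j) :=
  ⟨fun l => p (i + l), rfl, by simp [hij], fun l hl => hp (i + l) (by omega)⟩

lemma exists_hasWalk {α : Type*} {r : α → α → Prop} {a b : α}
    (h : Relation.ReflTransGen r a b) : ∃ k, HasWalk r k a b := by
  induction h with
  | refl => exact ⟨0, fun _ => a, rfl, rfl, by simp⟩
  | @tail b c _ h ih =>
    obtain ⟨k, hk⟩ := ih
    exact ⟨k + 1, hk.trans ⟨fun i => if i = 0 then b else c, by simp, by simp, by simpa⟩⟩

/-- A bicycle: the literals `p 1, …, p s` have different atoms, the literal `p 0` is the negation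
of one of them and `p (s + 1)` has the atom of one of them. -/
structure IsBicycle (s : ℕ) (p : ℕ → Literal n) : Prop where
  injOn : Set.InjOn (fun i => (p i).1) (Set.Icc 1 s)
  head : ∃ k ∈ Set.Icc 1 s, p 0 = (p k).neg
  last : ∃ k ∈ Set.Icc 1 s, (p (s + 1)).1 = (p k).1

/-- Distinct clauses give the factor q^(s+1). That `p 0` is the negation of an inner literal, not
merely on the same atom, rules out a coincidence with the first step. -/
lemma IsBicycle.injOn_imp {s : ℕ} {p : ℕ → Literal n} (h : IsBicycle s p) :
    Set.InjOn (fun i => imp (p i) (p (i + 1))) (Finset.range (s + 1)) := by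
  have key : ∀ i j, i < j → j ≤ s → imp (p i) (p (i + 1)) ≠ imp (p j) (p (j + 1)) := by
    intro i j hij hj heq
    have hmem : (p j).neg ∈ imp (p i) (p (i + 1)) := by rw [heq, mem_imp]; exact Or.inl rfl
    rcases mem_imp.1 hmem with h1 | h1
    · rw [neg_inj] at h1
      rcases Nat.eq_zero_or_pos i with rfl | hi
      · obtain ⟨k, hk, h0⟩ := h.head
        have : j = k := h.injOn ⟨hij, hj⟩ hk (by simp [h1, h0])
        subst this
        exact neg_ne_self _ (h0.symm.trans h1.symm)
      · exact hij.ne' (h.injOn ⟨by omega, hj⟩ ⟨hi, by omega⟩ (by simp [h1]))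
    · have : j = i + 1 := h.injOn ⟨by omega, hj⟩ ⟨by omega, by omega⟩ (by simp [← h1])
      subst this
      exact neg_ne_self _ h1
  intro i hi j hj hij
  simp only [Finset.coe_range, Set.mem_Iio] at hi hj
  rcases lt_trichotomy i j with h1 | h1 | h1
  · exact absurd hij (key i j h1 (by omega))
  · exact h1
  · exact absurd hij.symm (key j i h1 (by omega))

/-- An unsatisfiable set of 2-clauses contains a bicycle. -/
lemma exists_isBicycle {G : Set (Finset (Literal n))} (hG : ∀ s ∈ G, IsTwoClause s)
    (hsat : ¬ Satisfiable G) :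
    ∃ s p, IsBicycle s p ∧ ∀ i ∈ Finset.range (s + 1), imp (p i) (p (i + 1)) ∈ G := by
  have hex : ∃ k z, HasWalk (Implies G) k z z.neg ∧ ∃ m, HasWalk (Implies G) m z.neg z := by
    by_contra hcon
    refine hsat (satisfiable_of_forall_not_implies hG fun z h1 h2 => hcon ?_)
    obtain ⟨k, hk⟩ := exists_hasWalk h1
    exact ⟨k, z, hk, exists_hasWalk h2⟩
  obtain ⟨z, hk, m, hm⟩ := Nat.find_spec hex
  have hmin := fun k => Nat.find_min hex (m := k)
  generalize Nat.find hex = k at hk hmin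
  obtain ⟨p, h0, h1, h2, hp⟩ := exists_concat_walk hk hm
  have hk0 : 0 < k := by
    rcases Nat.eq_zero_or_pos k with rfl | h
    · exact absurd (h1.symm.trans h0) (neg_ne_self z)
    · exact h
  have hm0 : 0 < m := by
    rcases Nat.eq_zero_or_pos m with rfl | h
    · exact absurd (h1.symm.trans h2) (neg_ne_self z)
    · exact h
  -- A repeated literal could be cut out, and a literal followed by its negation would give a
  -- shorter walk with the same property for `p i`.
  have hinj : ∀ i j, 1 ≤ i → i < j → j ≤ k → (p i).1 ≠ (p j).1 := by
    intro i j hi hij hj heq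
    have w1 : HasWalk (Implies G) (i - 0) (p 0) (p i) := hasWalk_segment hp (by omega) (by omega)
    have w2 : HasWalk (Implies G) (k - j) (p j) (p k) := hasWalk_segment hp (by omega) (by omega)
    have w3 : HasWalk (Implies G) (j - i) (p i) (p j) := hasWalk_segment hp (by omega) (by omega)
    rw [h0] at w1
    rw [h1] at w2
    rcases eq_or_eq_neg heq with e | e
    · rw [e] at w1
      exact hmin (i - 0 + (k - j)) (by omega) ⟨z, w1.trans w2, m, hm⟩
    · have e' : p j = (p i).neg := by rw [e, neg_neg]
      rw [e'] at w2 w3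
      exact hmin (j - i) (by omega) ⟨p i, w3, _, (w2.trans hm).trans w1⟩
  -- The bicycle stops at the first repeated atom after position 0. There is one because the closed
  -- walk ends at `z`, on the atom of `p k`; by `hinj` it comes after `k`.
  have hex2 : ∃ j, ∃ i, 1 ≤ i ∧ i < j ∧ (p i).1 = (p j).1 :=
    ⟨k + m, k, hk0, by omega, by simp [h1, h2]⟩
  have hle : Nat.find hex2 ≤ k + m :=
    Nat.find_min' hex2 ⟨k, hk0, by omega, by simp [h1, h2]⟩
  obtain ⟨i, hi, hij, heq⟩ := Nat.find_spec hex2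
  have hmin2 := fun k => Nat.find_min hex2 (m := k)
  generalize Nat.find hex2 = j at *
  have hkj : k < j := by
    by_contra hcon
    exact hinj i j hi hij (by omega) heq
  refine ⟨j - 1, p, ⟨?_, ⟨k, ⟨hk0, by omega⟩, by simp [h0, h1]⟩, ⟨i, ⟨hi, by omega⟩, ?_⟩⟩, ?_⟩
  · rintro a ⟨ha, ha'⟩ b ⟨hb, hb'⟩ hab
    rcases lt_trichotomy a b with h | h | h
    · exact absurd ⟨a, ha, h, hab⟩ (hmin2 b (by omega))
    · exact h
    · exact absurd ⟨b, hb, h, hab.symm⟩ (hmin2 a (by omega))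
  · rw [Nat.sub_add_cancel (by omega)]; exact heq.symm
  · intro l hl
    rw [Finset.mem_range] at hl
    exact hp l (by omega)

/-- The sequence of literals with inner part `w`, first literal `u` and last literal `v`. -/
def bicycleSeq {s : ℕ} (w : Fin s → Literal n) (u v : Literal n) (i : ℕ) : Literal n :=
  if h : 1 ≤ i ∧ i ≤ s then w ⟨i - 1, by omega⟩ else if i = 0 then u else v

/-- The sequence of literals with inner part `w` that starts with the negation of `w k` and ends
with the literal of sign `b` on the atom of `w l`. -/
def bicycleOf {s : ℕ} (x : (Fin s → Literal n) × Fin s × Fin s × Bool) : ℕ → Literal n :=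
  bicycleSeq x.1 (x.1 x.2.1).neg ((x.1 x.2.2.1).1, x.2.2.2)

/-- A bicycle is encoded by its inner literals, two attachment indices and a sign, which leaves at
most (2n)^s * 2s^2 of them. -/
lemma IsBicycle.exists_eq {s : ℕ} {p : ℕ → Literal n} (h : IsBicycle s p) :
    ∃ x : (Fin s → Literal n) × Fin s × Fin s × Bool,
      ∀ i ≤ s + 1, bicycleOf x i = p i := by
  obtain ⟨k, ⟨hk, hk'⟩, h0⟩ := h.head
  obtain ⟨l, ⟨hl, hl'⟩, h1⟩ := h.last
  refine ⟨(fun i => p (i + 1), ⟨k - 1, by omega⟩, ⟨l - 1, by omega⟩, (p (s + 1)).2), ?_⟩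
  intro i hi
  unfold bicycleOf bicycleSeq
  split_ifs with h2 h3
  · simp [Nat.sub_add_cancel h2.1]
  · simp [Nat.sub_add_cancel hk, h3, h0]
  · obtain rfl : i = s + 1 := by omega
    simp only [Nat.sub_add_cancel hl]
    exact Prod.ext h1.symm rfl

lemma IsBicycle.congr {s : ℕ} {p p' : ℕ → Literal n} (h : IsBicycle s p)
    (hp : ∀ i ≤ s + 1, p' i = p i) : IsBicycle s p' := by
  refine ⟨fun i hi j hj hij => h.injOn hi hj ?_, ?_, ?_⟩
  · simpa [hp i (by have := hi.2; omega), hp j (by have := hj.2; omega)] using hij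
  · obtain ⟨k, hk, h0⟩ := h.head
    exact ⟨k, hk, by rw [hp 0 (by omega), hp k (by have := hk.2; omega), h0]⟩
  · obtain ⟨k, hk, h0⟩ := h.last
    exact ⟨k, hk, by rw [hp (s + 1) le_rfl, hp k (by have := hk.2; omega), h0]⟩

lemma IsBicycle.le {s : ℕ} {p : ℕ → Literal n} (h : IsBicycle s p) : s ≤ n := by
  have := Finset.card_le_card_of_injOn (s := Finset.Icc 1 s) (t := (Finset.univ : Finset (Fin n)))
    (fun i => (p i).1) (by simp) (by simpa using h.injOn)
  simpa using this

/-! ### First moment bound and the case c < 1 -/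

lemma clauseProb_nonneg (c : ℝ) (m n : ℕ) : 0 ≤ (clauseProb c m n : ℝ) := (clauseProb c m n).2.1

lemma clauseProb_le_one (c : ℝ) (m n : ℕ) : (clauseProb c m n : ℝ) ≤ 1 := (clauseProb c m n).2.2

lemma projProb_nonneg (c : ℝ) (m n r : ℕ) : 0 ≤ projProb c m n r := by
  have := pow_le_one₀ (n := r) (sub_nonneg.2 (clauseProb_le_one c m n))
    (by linarith [clauseProb_nonneg c m n])
  unfold projProb
  linarith

/-- A step of a bicycle may fail to be a 2-clause, for instance when its last literal has the atom
of the preceding one. Such a bicycle never occurs, so an inequality suffices. -/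
lemma randomFormula_real_proj_le (c : ℝ) (m n : ℕ) (Λ : Finset (Literal m))
    (A : Finset (Finset (Literal n))) :
    (randomFormula c m n).real {F | ∀ s ∈ A, s ∈ F.proj Λ} ≤ projProb c m n Λ.card ^ A.card := by
  by_cases hA : ∀ s ∈ A, IsTwoClause s
  · exact (randomFormula_real_proj c m n Λ A hA).le
  · have : {F : Formula m n | ∀ s ∈ A, s ∈ F.proj Λ} = ∅ :=
      Set.eq_empty_of_forall_notMem fun F hF =>
        hA fun s hs => Formula.isTwoClause_of_mem_proj (hF s hs)
    rw [this, measureReal_empty]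
    exact pow_nonneg (projProb_nonneg ..) _

lemma randomFormula_real_not_satisfiable_le (c : ℝ) (m n : ℕ) (Λ : Finset (Literal m)) :
    (randomFormula c m n).real {F | ¬ Satisfiable (F.proj Λ)} ≤
      ∑ s ∈ Finset.range (n + 1),
        ((2 * n : ℝ) ^ s * (2 * s ^ 2)) * projProb c m n Λ.card ^ (s + 1) := by
  let A (s : ℕ) (x : (Fin s → Literal n) × Fin s × Fin s × Bool) : Finset (Finset (Literal n)) :=
    (Finset.range (s + 1)).image fun i => imp (bicycleOf x i) (bicycleOf x (i + 1))
  have hsub : {F : Formula m n | ¬ Satisfiable (F.proj Λ)} ⊆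
      ⋃ s ∈ Finset.range (n + 1), ⋃ x ∈ Finset.univ.filter fun x => IsBicycle s (bicycleOf x),
        {F | ∀ t ∈ A s x, t ∈ F.proj Λ} := by
    intro F hF
    obtain ⟨s, p, hb, hp⟩ := exists_isBicycle (fun _ => Formula.isTwoClause_of_mem_proj) hF
    obtain ⟨x, hx⟩ := hb.exists_eq
    simp only [Set.mem_iUnion]
    refine ⟨s, Finset.mem_range.2 (Nat.lt_succ_of_le hb.le), x, by simpa using hb.congr hx, ?_⟩
    intro t ht
    obtain ⟨i, hi, rfl⟩ := Finset.mem_image.1 ht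
    have := hp i hi
    rw [Finset.mem_range] at hi
    rwa [hx i (by omega), hx (i + 1) (by omega)]
  refine (measureReal_mono hsub (measure_ne_top _ _)).trans ((measureReal_biUnion_finset_le _ _).trans ?_)
  refine Finset.sum_le_sum fun s _ => ((measureReal_biUnion_finset_le _ _).trans ?_)
  have hb : ∀ x ∈ Finset.univ.filter fun x : (Fin s → Literal n) × Fin s × Fin s × Bool =>
      IsBicycle s (bicycleOf x), (randomFormula c m n).real {F | ∀ t ∈ A s x, t ∈ F.proj Λ} ≤
        projProb c m n Λ.card ^ (s + 1) := by
    intro x hx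
    have hcard : (A s x).card = s + 1 := by
      rw [Finset.card_image_of_injOn (Finset.mem_filter.1 hx).2.injOn_imp, Finset.card_range]
    simpa only [hcard] using randomFormula_real_proj_le c m n Λ (A s x)
  refine (Finset.sum_le_card_nsmul _ _ _ hb).trans ?_
  rw [nsmul_eq_mul]
  refine mul_le_mul_of_nonneg_right ?_ (pow_nonneg (projProb_nonneg ..) _)
  refine (Nat.cast_le.2 (Finset.card_le_univ _)).trans (le_of_eq ?_)
  simp only [Fintype.card_prod, Fintype.card_fun, Fintype.card_fin, Fintype.card_bool]
  push_cast
  ring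

lemma projProb_le (c : ℝ) (hc : 0 ≤ c) (m n r : ℕ) :
    projProb c m n r ≤ r * (c / (4 * m * n)) := by
  have h1 := one_add_mul_le_pow (a := -(clauseProb c m n : ℝ))
    (by linarith [clauseProb_le_one c m n]) r
  have h2 : (clauseProb c m n : ℝ) ≤ c / (4 * m * n) := by
    rw [clauseProb, Set.coe_projIcc]
    exact max_le (by positivity) (min_le_right _ _)
  have h3 := mul_le_mul_of_nonneg_left h2 (Nat.cast_nonneg (α := ℝ) r)
  unfold projProb
  rw [← sub_eq_add_neg] at h1
  linarith

theorem tendsto_probTrue_one (c : ℝ) (hc : 0 < c) (hc1 : c < 1) (m : ℕ → ℕ)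
    (hm : ∀ᶠ n : ℕ in Filter.atTop, 1 ≤ m n) :
    Filter.Tendsto (fun n : ℕ => probTrue c (m n) n) Filter.atTop (nhds 1) := by
  have hs : Summable fun s : ℕ => (s : ℝ) ^ 2 * c ^ s :=
    summable_pow_mul_geometric_of_norm_lt_one 2 (by rwa [Real.norm_of_nonneg hc.le])
  have key : ∀ᶠ n : ℕ in Filter.atTop,
      1 - (∑' s : ℕ, (s : ℝ) ^ 2 * c ^ s) * c / n ≤ probTrue c (m n) n := by
    filter_upwards [hm, Filter.eventually_ge_atTop 1] with n hm hn
    have hn0 : (0 : ℝ) < n := by exact_mod_cast hn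
    have hm0 : (0 : ℝ) < m n := by exact_mod_cast hm
    have h1 := randomFormula_real_not_satisfiable_le c (m n) n Finset.univ
    -- Union bound over the 2m universal literals: 2m * c/(4mn) = c/(2n).
    have hq : projProb c (m n) n (Finset.univ : Finset (Literal (m n))).card ≤ c / (2 * n) := by
      refine (projProb_le c hc.le _ _ _).trans (le_of_eq ?_)
      simp only [Finset.card_univ, Fintype.card_prod, Fintype.card_fin, Fintype.card_bool]
      push_cast
      field_simp
      ring
    have h2 : ∑ s ∈ Finset.range (n + 1), ((2 * n : ℝ) ^ s * (2 * s ^ 2)) *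
        projProb c (m n) n (Finset.univ : Finset (Literal (m n))).card ^ (s + 1) ≤
        (∑' s : ℕ, (s : ℝ) ^ 2 * c ^ s) * c / n := by
      calc _ ≤ ∑ s ∈ Finset.range (n + 1), ((s : ℝ) ^ 2 * c ^ s) * (c / n) := by
            refine Finset.sum_le_sum fun s _ => ?_
            refine (mul_le_mul_of_nonneg_left (pow_le_pow_left₀ (projProb_nonneg ..) hq _)
              (by positivity)).trans (le_of_eq ?_)
            rw [div_pow, pow_succ (2 * (n : ℝ))]
            field_simp
            ring
        _ ≤ _ := by
            rw [← Finset.sum_mul, mul_div_assoc]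
            exact mul_le_mul_of_nonneg_right
              (hs.sum_le_tsum _ fun _ _ => by positivity) (by positivity)
    have h3 : 1 - (randomFormula c (m n) n).real {F | ¬ Satisfiable (F.proj Finset.univ)} ≤
        probTrue c (m n) n := by
      have h4 := probReal_compl_eq_one_sub (μ := randomFormula c (m n) n)
        (s := {F : Formula (m n) n | ¬ Satisfiable (F.proj Finset.univ)}) .of_discrete
      rw [← h4]
      refine measureReal_mono fun F hF => Formula.isTrue_of_satisfiable ?_
      simpa using hF
    linarith
  refine tendsto_of_tendsto_of_tendsto_of_le_of_le' ?_ tendsto_const_nhds key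
    (Filter.Eventually.of_forall fun n => measureReal_le_one)
  simpa using (tendsto_const_div_atTop_nhds_zero_nat
    ((∑' s : ℕ, (s : ℝ) ^ 2 * c ^ s) * c)).const_sub 1

/-! ### Weighted walks and perturbations of the all-ones kernel -/

section WalkSum

/-- The sequence with first term `u`, then `f`, then constantly `v`. -/
def pathSeq {α : Type*} {k : ℕ} (u : α) (f : Fin k → α) (v : α) (i : ℕ) : α :=
  if i = 0 then u else if h : i - 1 < k then f ⟨i - 1, h⟩ else v

variable {α : Type*}

@[simp] lemma pathSeq_zero {k : ℕ} (u : α) (f : Fin k → α) (v : α) : pathSeq u f v 0 = u := rfl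

lemma pathSeq_succ {k : ℕ} (u : α) (f : Fin k → α) (v : α) {i : ℕ} (h : i < k) :
    pathSeq u f v (i + 1) = f ⟨i, h⟩ := by simp [pathSeq, h]

@[simp] lemma pathSeq_last {k : ℕ} (u : α) (f : Fin k → α) (v : α) :
    pathSeq u f v (k + 1) = v := by simp [pathSeq]

lemma pathSeq_cons {k : ℕ} (u a : α) (f : Fin k → α) (v : α) (i : ℕ) :
    pathSeq u (Fin.cons a f) v (i + 1) = pathSeq a f v i := by
  rcases i with _ | i
  · simp [pathSeq]
  · by_cases h : i < k
    · rw [pathSeq_succ _ _ _ (Nat.succ_lt_succ h), pathSeq_succ _ _ _ h]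
      exact Fin.cons_succ (α := fun _ => α) a f ⟨i, h⟩
    · simp [pathSeq, h]

/-- The indicator function of a point. -/
noncomputable def pointMass (v : α) : α → ℝ := Pi.single v 1

variable [Fintype α]

/-- The linear operator with kernel `R`. -/
def kernelOp (R : α → α → ℝ) (φ : α → ℝ) (u : α) : ℝ := ∑ w, R u w * φ w

/-- This is the expansion of an entry of the matrix power R^(k+1) over the k intermediate vertices.
-/
lemma sum_prod_pathSeq (R : α → α → ℝ) (v : α) (k : ℕ) : ∀ u : α,
    ∑ f : Fin k → α, ∏ i : Fin (k + 1), R (pathSeq u f v i) (pathSeq u f v (i + 1)) =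
      (kernelOp R)^[k + 1] (pointMass v) u := by
  induction k with
  | zero => intro u; simp [kernelOp, pointMass, Pi.single_apply, pathSeq]
  | succ k ih =>
    intro u
    rw [Function.iterate_succ_apply', kernelOp, ← (Fin.consEquiv fun _ => α).sum_comp,
      Fintype.sum_prod_type]
    refine Finset.sum_congr rfl fun a _ => ?_
    rw [← ih, Finset.mul_sum]
    refine Finset.sum_congr rfl fun f _ => ?_
    rw [Fin.prod_univ_succ]
    simp only [Fin.consEquiv, Equiv.coe_fn_mk, Fin.val_succ, pathSeq_cons]
    simp

/-- A potential `h` that controls the growth under iteration of a perturbation of the kernel that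
is constantly `1`. -/
structure IsPotential (M : α → α → ℝ) (h : α → ℝ) (lam S : ℝ) : Prop where
  kernel_nonneg : ∀ u v, 0 ≤ M u v
  nonneg : ∀ u, 0 ≤ h u
  le_two : ∀ u, h u ≤ 2
  one_le : ∀ u, h u ≠ 0 → 1 ≤ h u
  sum_le : ∑ u, h u ≤ S
  row_sum_le : ∀ u, ∑ v, M u v ≤ h u
  row_sum_mul_le : ∀ u, ∑ v, M u v * h v ≤ lam * h u
  kernel_eq_zero : ∀ u v, h v = 0 → M u v = 0

/-- Bounds of the form a + b h are preserved: one application, divided by `L`, replaces (a, b) by (a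
+ b σ, β (a + b)). Since β (1 + K) ≤ K, the ratio b / a stays below K up to the decaying term B β^j,
so a grows by a factor of about 1 + K σ per step. -/
lemma IsPotential.iterate_le {M : α → α → ℝ} {h : α → ℝ} {lam S r β K σ L a₀ B : ℝ}
    (H : IsPotential M h lam S) (hL : L = Fintype.card α) (hr : 0 ≤ r) (hβ : 0 ≤ β)
    (hrβ : r ≤ β * L) (hrl : r * lam ≤ β * L) (hK : 0 ≤ K) (hKβ : β * (1 + K) ≤ K)
    (hσ : 0 ≤ σ) (hS : S ≤ σ * L) (ha₀ : 0 ≤ a₀) (hB : 0 ≤ B)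
    {φ : α → ℝ} (hφ : ∀ u, φ u ≤ a₀ + B * h u) (j : ℕ) :
    ∃ a b : ℝ, 0 ≤ a ∧ 0 ≤ b ∧ a ≤ (a₀ + j * B * σ) * (1 + K * σ) ^ j ∧ b ≤ K * a + B * β ^ j ∧
      ∀ u, (kernelOp fun u v => 1 + r * M u v)^[j] φ u ≤ L ^ j * (a + b * h u) := by
  induction j with
  | zero =>
    exact ⟨a₀, B, ha₀, hB, by simp, by simp; positivity, by simpa using hφ⟩
  | succ j ih =>
    obtain ⟨a, b, ha, hb, hab, hbb, hle⟩ := ih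
    have hL0 : 0 ≤ L := hL ▸ Nat.cast_nonneg _
    have hbσ : 0 ≤ b * σ := mul_nonneg hb hσ
    refine ⟨a + b * σ, β * (a + b), by positivity, by positivity, ?_, ?_, fun u => ?_⟩
    · have h1 : b * σ ≤ (K * a + B * β ^ j) * σ := mul_le_mul_of_nonneg_right hbb hσ
      have hβ1 : β ≤ 1 := by nlinarith
      have h2 : B * β ^ j * σ ≤ B * σ * (1 + K * σ) ^ (j + 1) := by
        have h3 : β ^ j ≤ (1 + K * σ) ^ (j + 1) :=
          (pow_le_one₀ hβ hβ1).trans (one_le_pow₀ (by nlinarith [mul_nonneg hK hσ]))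
        have := mul_le_mul_of_nonneg_left h3 (mul_nonneg hB hσ)
        linarith
      have h4 := mul_le_mul_of_nonneg_right hab (show 0 ≤ 1 + K * σ by positivity)
      push_cast
      rw [pow_succ] at h2 ⊢
      nlinarith
    · have h1 : β * b ≤ β * (K * a + B * β ^ j) := mul_le_mul_of_nonneg_left hbb hβ
      have h2 : β * (1 + K) * a ≤ K * a := mul_le_mul_of_nonneg_right hKβ ha
      have h3 : 0 ≤ K * (b * σ) := mul_nonneg hK hbσ
      rw [pow_succ]
      linarith
    · rw [Function.iterate_succ_apply', kernelOp]
      have hM := H.kernel_nonneg u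
      calc _ ≤ ∑ w, (1 + r * M u w) * (L ^ j * (a + b * h w)) := by
            refine Finset.sum_le_sum fun w _ => mul_le_mul_of_nonneg_left (hle w) ?_
            have := mul_nonneg hr (hM w)
            linarith
        _ = L ^ j * (L * a + b * (∑ w, h w) + a * r * (∑ w, M u w) +
              b * r * ∑ w, M u w * h w) := by
            have : L * a = ∑ w : α, a := by simp [hL]
            rw [this, Finset.mul_sum, Finset.mul_sum, Finset.mul_sum, ← Finset.sum_add_distrib,
              ← Finset.sum_add_distrib, ← Finset.sum_add_distrib, Finset.mul_sum]
            exact Finset.sum_congr rfl fun w _ => by ring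
        _ ≤ L ^ j * (L * ((a + b * σ) + β * (a + b) * h u)) := by
            refine mul_le_mul_of_nonneg_left ?_ (by positivity)
            have h1 : b * (∑ w, h w) ≤ b * (σ * L) :=
              mul_le_mul_of_nonneg_left (H.sum_le.trans hS) hb
            have h2 : a * r * (∑ w, M u w) ≤ a * (β * L) * h u :=
              mul_le_mul (mul_le_mul_of_nonneg_left hrβ ha) (H.row_sum_le u)
                (Finset.sum_nonneg fun w _ => hM w) (by positivity)
            have h3 : b * r * (∑ w, M u w * h w) ≤ b * r * (lam * h u) :=
              mul_le_mul_of_nonneg_left (H.row_sum_mul_le u) (by positivity)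
            have h4 : b * (r * lam) * h u ≤ b * (β * L) * h u :=
              mul_le_mul_of_nonneg_right (mul_le_mul_of_nonneg_left hrl hb) (H.nonneg u)
            linarith
        _ = _ := by ring

lemma IsPotential.entry_le {M : α → α → ℝ} {h : α → ℝ} {lam S r β K σ L : ℝ}
    (H : IsPotential M h lam S) (hL : L = Fintype.card α) (hr : 0 ≤ r) (hβ : 0 ≤ β)
    (hrβ : r ≤ β * L) (hrl : r * lam ≤ β * L) (hK : 0 ≤ K) (hKβ : β * (1 + K) ≤ K)
    (hσ : 0 ≤ σ) (hS : S ≤ σ * L) (k : ℕ) (u v : α) :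
    L * (kernelOp fun u v => 1 + r * M u v)^[k + 1] (pointMass v) u ≤
      L ^ (k + 1) * ((1 + (k + 1) * (L * σ)) * (1 + K * σ) ^ (k + 1) * (1 + 2 * K) +
        2 * (L * β ^ (k + 1))) ∧
    (h u = 0 → h v = 0 → L * (kernelOp fun u v => 1 + r * M u v)^[k + 1] (pointMass v) u ≤
      L ^ (k + 1) * (1 + K * σ) ^ (k + 1)) := by
  have hL0 : 0 ≤ L := hL ▸ Nat.cast_nonneg _
  have hG : 1 ≤ 1 + K * σ := by nlinarith [mul_nonneg hK hσ]
  have hu0 := H.nonneg u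
  have hu2 := H.le_two u
  by_cases hv : h v = 0
  · have hφ : ∀ w, (kernelOp (fun u v => 1 + r * M u v) (pointMass v)) w ≤ 1 + 0 * h w := by
      intro w
      simp [kernelOp, pointMass, Pi.single_apply, H.kernel_eq_zero w v hv]
    obtain ⟨a, b, ha, hb, hab, hbb, hle⟩ := H.iterate_le hL hr hβ hrβ hrl hK hKβ hσ hS zero_le_one
      le_rfl hφ k
    have hle := mul_le_mul_of_nonneg_left (hle u) hL0
    rw [← Function.iterate_succ_apply, ← mul_assoc, ← pow_succ'] at hle
    have haG : a ≤ (1 + K * σ) ^ (k + 1) := by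
      refine hab.trans ?_
      simpa using pow_le_pow_right₀ hG k.le_succ
    constructor
    · refine hle.trans (mul_le_mul_of_nonneg_left ?_ (by positivity))
      have h1 : b * h u ≤ K * a * 2 :=
        mul_le_mul (by simpa using hbb) hu2 hu0 (by positivity)
      have h2 : a * (1 + 2 * K) ≤ (1 + K * σ) ^ (k + 1) * (1 + 2 * K) :=
        mul_le_mul_of_nonneg_right haG (by positivity)
      have h3 : 0 ≤ (k + 1) * (L * σ) * ((1 + K * σ) ^ (k + 1) * (1 + 2 * K)) := by positivity
      have h4 : 0 ≤ L * β ^ (k + 1) := by positivity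
      linarith
    · intro hu _
      refine hle.trans (mul_le_mul_of_nonneg_left ?_ (by positivity))
      simpa [hu] using haG
  · refine ⟨?_, fun _ h' => absurd h' hv⟩
    -- Here `h v` is at least 1, so the point mass is dominated by the potential itself.
    have hφ : ∀ w, pointMass v w ≤ 0 + 1 * h w := by
      intro w
      by_cases hw : w = v
      · subst hw; simpa [pointMass] using H.one_le w hv
      · simpa [pointMass, hw] using H.nonneg w
    obtain ⟨a, b, ha, hb, hab, hbb, hle⟩ := H.iterate_le hL hr hβ hrβ hrl hK hKβ hσ hS le_rfl
      zero_le_one hφ (k + 1)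
    refine (mul_le_mul_of_nonneg_left (hle u) hL0).trans ?_
    rw [mul_left_comm]
    refine mul_le_mul_of_nonneg_left ?_ (by positivity)
    have h1 : b * h u ≤ (K * a + 1 * β ^ (k + 1)) * 2 := mul_le_mul hbb hu2 hu0 (by positivity)
    have h2 : L * (a * (1 + 2 * K)) ≤
        L * ((0 + ((k + 1 : ℕ) : ℝ) * 1 * σ) * (1 + K * σ) ^ (k + 1) * (1 + 2 * K)) := by
      refine mul_le_mul_of_nonneg_left (mul_le_mul_of_nonneg_right hab (by positivity)) hL0
    have h3 : 0 ≤ (1 + K * σ) ^ (k + 1) * (1 + 2 * K) := by positivity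
    have h5 := mul_le_mul_of_nonneg_left h1 hL0
    push_cast at h2
    linarith

end WalkSum

/-! ### Snakes and their potentials -/

/-- A snake: a hub atom and two sequences of `k` literals, all on different atoms. They are the
inner parts of two paths of implications between the two literals of the hub. -/
abbrev Snake (n k : ℕ) : Type := (Option (Bool × Fin k) ↪ Fin n) × (Bool × Fin k → Bool)

namespace Snake
variable {n k : ℕ}

/-- The hub atom of a snake. -/
def hub (A : Snake n k) : Fin n := A.1 none

/-- The literals of the arm `b` of a snake. -/
def arm (A : Snake n k) (b : Bool) (j : Fin k) : Literal n := (A.1 (some (b, j)), A.2 (b, j))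

/-- The path from the literal of sign `b` on the hub to its negation. -/
def path (A : Snake n k) (b : Bool) : ℕ → Literal n :=
  pathSeq (A.hub, b) (A.arm b) (A.hub, !b)

@[simp] lemma path_zero (A : Snake n k) (b : Bool) : A.path b 0 = (A.hub, b) := rfl

@[simp] lemma path_last (A : Snake n k) (b : Bool) : A.path b (k + 1) = (A.hub, !b) :=
  pathSeq_last ..

lemma path_inner (A : Snake n k) (b : Bool) {i : ℕ} (h1 : 1 ≤ i) (h2 : i ≤ k) :
    A.path b i = A.arm b ⟨i - 1, by omega⟩ := by
  obtain ⟨j, rfl⟩ := Nat.exists_eq_add_of_le' h1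
  exact pathSeq_succ _ _ _ (by omega)

/-- An inner atom occurs at one place only; the hub is the only atom that repeats. All uniqueness
arguments for snakes rest on this. -/
lemma eq_of_path_fst_eq (A : Snake n k) {b b' : Bool} {i i' : ℕ} (h1 : 1 ≤ i) (h2 : i ≤ k)
    (h' : i' ≤ k + 1) (h : (A.path b i).1 = (A.path b' i').1) : b = b' ∧ i = i' := by
  rw [path_inner A b h1 h2] at h
  rcases Nat.eq_zero_or_pos i' with rfl | h3
  · have := A.1.injective h
    simp at this
  rcases Nat.lt_or_ge k i' with h4 | h4
  · obtain rfl : i' = k + 1 := by omega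
    rw [path_last] at h
    have := A.1.injective h
    simp at this
  · rw [path_inner A b' h3 h4] at h
    have := A.1.injective h
    simp at this
    exact ⟨this.1, by omega⟩

/-- The clause that expresses the step `x.2` of the path `x.1`. -/
def clause (A : Snake n k) (x : Bool × Fin (k + 1)) : Finset (Literal n) :=
  imp (A.path x.1 x.2) (A.path x.1 (x.2 + 1))

/-- The clauses of a snake. -/
def clauses (A : Snake n k) : Finset (Finset (Literal n)) := Finset.univ.image A.clause

lemma isTwoClause_clause (hk : 1 ≤ k) (A : Snake n k) (x : Bool × Fin (k + 1)) :
    IsTwoClause (A.clause x) := by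
  have hx := x.2.is_lt
  have h : (A.path x.1 x.2).1 ≠ (A.path x.1 (x.2 + 1)).1 := by
    intro h
    rcases Nat.eq_zero_or_pos (x.2 : ℕ) with h0 | h0
    · have := A.eq_of_path_fst_eq (by omega) (by omega) (by omega) h.symm
      omega
    · have := A.eq_of_path_fst_eq h0 (by omega) (by omega) h
      omega
  constructor
  · refine Finset.card_pair fun h' => h ?_
    rw [← h', neg_fst]
  · intro a ha b hb hab
    simp only [clause, Finset.mem_coe, mem_imp] at ha hb
    rcases ha with rfl | rfl <;> rcases hb with rfl | rfl
    · rfl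
    · exact absurd hab h
    · exact absurd hab.symm h
    · rfl

lemma clause_injective (hk : 1 ≤ k) (A : Snake n k) : Function.Injective A.clause := by
  have key : ∀ x y : Bool × Fin (k + 1), 1 ≤ (x.2 : ℕ) → A.clause x = A.clause y → x = y := by
    rintro ⟨b, i⟩ ⟨b', i'⟩ hi h
    have hmem : (A.path b i).neg ∈ A.clause (b', i') := by
      rw [← h]; exact mem_imp.2 (Or.inl rfl)
    have := i.is_lt
    have := i'.is_lt
    rcases mem_imp.1 hmem with e | e
    · have e1 := congrArg Prod.fst e
      simp only [neg_fst] at e1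
      have := A.eq_of_path_fst_eq hi (by omega) (by omega) e1
      exact Prod.ext this.1 (Fin.ext this.2)
    · have e1 := congrArg Prod.fst e
      simp only [neg_fst] at e1
      have h3 := A.eq_of_path_fst_eq hi (by omega) (by omega) e1
      dsimp only at e
      rw [← h3.1, ← h3.2] at e
      exact absurd e (neg_ne_self _)
  intro x y h
  by_cases hx : 1 ≤ (x.2 : ℕ)
  · exact key x y hx h
  by_cases hy : 1 ≤ (y.2 : ℕ)
  · exact (key y x hy h.symm).symm
  have hx0 : (x.2 : ℕ) = 0 := by omega
  have hy0 : (y.2 : ℕ) = 0 := by omega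
  have hmem : A.path x.1 1 ∈ A.clause y := by
    rw [← h, clause, hx0]; exact mem_imp.2 (Or.inr rfl)
  rw [clause, hy0] at hmem
  refine Prod.ext ?_ (Fin.ext (by omega))
  rcases mem_imp.1 hmem with e | e
  · have := (A.eq_of_path_fst_eq (i' := 0) le_rfl hk (by omega) (congrArg Prod.fst e)).2
    omega
  · exact (A.eq_of_path_fst_eq le_rfl hk (by omega) (congrArg Prod.fst e)).1

lemma card_clauses (hk : 1 ≤ k) (A : Snake n k) : A.clauses.card = 2 * (k + 1) := by
  rw [clauses, Finset.card_image_of_injective _ (A.clause_injective hk)]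
  simp

/-- An assignment makes one of the two hub literals true, and the path that starts there propagates
truth to its negation. -/
lemma not_satisfiable (A : Snake n k) {G : Set (Finset (Literal n))}
    (h : ∀ s ∈ A.clauses, s ∈ G) : ¬ Satisfiable G := by
  rintro ⟨J, hJ⟩
  have key : ∀ i ≤ k + 1, (A.path (J A.hub) i).Holds J := by
    intro i
    induction i with
    | zero => intro _; rfl
    | succ i ih =>
      intro hi
      have h1 := ih (by omega)
      obtain ⟨l, hl, hlJ⟩ := hJ _ (h (A.clause (J A.hub, ⟨i, by omega⟩))
        (Finset.mem_image_of_mem _ (Finset.mem_univ _)))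
      rcases mem_imp.1 hl with rfl | rfl
      · exfalso
        simp only [Holds, neg_fst] at h1 hlJ
        rw [h1] at hlJ
        simp [Literal.neg] at hlJ
      · exact hlJ
  have := key (k + 1) le_rfl
  simp [Holds] at this

/-- The number of times that the implication from `u` to `v` is a step of a snake, or the
contrapositive of a step. -/
noncomputable def kernel (A : Snake n k) (u v : Literal n) : ℝ :=
  ∑ x : Bool × Fin (k + 1),
    ((if u = A.path x.1 x.2 then if v = A.path x.1 (x.2 + 1) then 1 else 0 else 0) +
      if u = (A.path x.1 (x.2 + 1)).neg then if v = (A.path x.1 x.2).neg then 1 else 0 else 0)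

lemma one_le_kernel (A : Snake n k) {u v : Literal n} (h : imp u v ∈ A.clauses) :
    1 ≤ A.kernel u v := by
  obtain ⟨x, -, hx⟩ := Finset.mem_image.1 h
  refine le_trans ?_ (Finset.single_le_sum
    (fun y _ => add_nonneg (by split_ifs <;> simp) (by split_ifs <;> simp)) (Finset.mem_univ x))
  have h1 : u.neg ∈ A.clause x := by rw [hx]; exact mem_imp.2 (Or.inl rfl)
  have h2 : v ∈ A.clause x := by rw [hx]; exact mem_imp.2 (Or.inr rfl)
  have h3 : (A.path x.1 x.2).neg ∈ imp u v := by rw [← hx]; exact mem_imp.2 (Or.inl rfl)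
  have h4 : A.path x.1 (x.2 + 1) ∈ imp u v := by rw [← hx]; exact mem_imp.2 (Or.inr rfl)
  rw [clause] at h1 h2
  rw [mem_imp] at h1 h2 h3 h4
  generalize A.path x.1 x.2 = a at *
  generalize A.path x.1 (x.2 + 1) = b at *
  have : (u = a ∧ v = b) ∨ (u = b.neg ∧ v = a.neg) := by
    rw [neg_inj, neg_eq_iff (v := b)] at h1
    rw [neg_inj] at h3
    rcases h1 with rfl | rfl
    · rcases h4 with rfl | rfl
      · rcases h2 with rfl | rfl <;> simp
      · simp
    · rcases h3 with rfl | h3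
      · rcases h2 with rfl | rfl <;> simp
      · simp [← h3]
  rcases this with ⟨rfl, rfl⟩ | ⟨rfl, rfl⟩
  · simp; split_ifs <;> simp
  · simp; split_ifs <;> simp

/-- The potential of a literal: it grows linearly from `1` to `2` along the paths of the snake and
along their contrapositives. -/
noncomputable def potential (A : Snake n k) (u : Literal n) : ℝ :=
  ∑ x : Bool × Fin (k + 1),
    ((if u = A.path x.1 x.2 then 1 + (x.2 : ℝ) / (k + 1) else 0) +
      if u = (A.path x.1 (x.2 + 1)).neg then 1 + (k - x.2 : ℝ) / (k + 1) else 0)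

lemma potential_eq (A : Snake n k) (u : Literal n) : A.potential u =
    (∑ x : Bool × Fin (k + 1), if u = A.path x.1 x.2 then 1 + (x.2 : ℝ) / (k + 1) else 0) +
    ∑ x : Bool × Fin (k + 1),
      if u = (A.path x.1 (x.2 + 1)).neg then 1 + (k - x.2 : ℝ) / (k + 1) else 0 := by
  rw [potential, Finset.sum_add_distrib]

/-- Two summands survive, each equal to 1: the start of path `b` and the start of its
contrapositive. They reflect the two implications leaving a hub literal. -/
lemma potential_hub (A : Snake n k) (b : Bool) : A.potential (A.hub, b) = 2 := by
  have h1 : ∀ (b' : Bool) (i : ℕ), 1 ≤ i → i ≤ k → (A.path b' i).1 ≠ A.hub := fun b' i hi hi' h =>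
    by have := A.eq_of_path_fst_eq (b' := b) (i' := 0) hi hi' (by omega) h; omega
  rw [potential_eq, Finset.sum_eq_single_of_mem (b, 0) (Finset.mem_univ _),
    Finset.sum_eq_single_of_mem (b, Fin.last k) (Finset.mem_univ _)]
  · simp [Literal.neg]; norm_num
  · rintro ⟨b', i⟩ - hne
    refine if_neg fun e => hne ?_
    have hi := i.is_lt
    by_cases h : (i : ℕ) + 1 ≤ k
    · exact absurd (congrArg Prod.fst e).symm (h1 b' _ (by omega) h)
    · have h' : (i : ℕ) = k := by omega
      simp only [h', path_last] at e
      refine Prod.ext ?_ (Fin.ext h')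
      simpa [Literal.neg] using (congrArg Prod.snd e).symm
  · rintro ⟨b', i⟩ - hne
    refine if_neg fun e => hne ?_
    have hi := i.is_lt
    by_cases h : 1 ≤ (i : ℕ)
    · exact absurd (congrArg Prod.fst e).symm (h1 b' _ h (by omega))
    · have h' : (i : ℕ) = 0 := by omega
      simp only [h', path_zero] at e
      exact Prod.ext (congrArg Prod.snd e).symm (Fin.ext h')

lemma potential_path (A : Snake n k) (b : Bool) {i : ℕ} (h1 : 1 ≤ i) (h2 : i ≤ k) :
    A.potential (A.path b i) = 1 + (i : ℝ) / (k + 1) := by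
  rw [potential_eq, Finset.sum_eq_single_of_mem (b, ⟨i, by omega⟩) (Finset.mem_univ _),
    Finset.sum_eq_zero]
  · simp
  · rintro ⟨b', j⟩ -
    refine if_neg fun e => ?_
    have hj := j.is_lt
    have e1 := congrArg Prod.fst e
    simp only [neg_fst] at e1
    obtain ⟨rfl, h⟩ := A.eq_of_path_fst_eq h1 h2 (by omega) e1
    dsimp only at e
    rw [← h] at e
    exact neg_ne_self _ e.symm
  · rintro ⟨b', j⟩ - hne
    refine if_neg fun e => hne ?_
    have hj := j.is_lt
    have e1 := congrArg Prod.fst e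
    obtain ⟨rfl, h⟩ := A.eq_of_path_fst_eq h1 h2 (by omega) e1
    exact Prod.ext rfl (Fin.ext h.symm)

lemma potential_neg_path (A : Snake n k) (b : Bool) {i : ℕ} (h1 : 1 ≤ i) (h2 : i ≤ k) :
    A.potential (A.path b i).neg = 1 + (k + 1 - i : ℝ) / (k + 1) := by
  rw [potential_eq, add_comm,
    Finset.sum_eq_single_of_mem (b, ⟨i - 1, by omega⟩) (Finset.mem_univ _), Finset.sum_eq_zero]
  · simp only [Nat.sub_add_cancel h1, if_true]
    push_cast [Nat.cast_sub h1]
    ring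
  · rintro ⟨b', j⟩ -
    refine if_neg fun e => ?_
    have hj := j.is_lt
    have e1 := congrArg Prod.fst e
    simp only [neg_fst] at e1
    obtain ⟨rfl, h⟩ := A.eq_of_path_fst_eq h1 h2 (by omega) e1
    dsimp only at e
    rw [← h] at e
    exact neg_ne_self _ e
  · rintro ⟨b', j⟩ - hne
    refine if_neg fun e => hne ?_
    have hj := j.is_lt
    have e1 := congrArg Prod.fst e
    simp only [neg_fst] at e1
    obtain ⟨rfl, h⟩ := A.eq_of_path_fst_eq h1 h2 (by omega) e1
    exact Prod.ext rfl (Fin.ext (by simp only; omega))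

/-- The linear formula persists at the end of the path, where its value 2 agrees with that of the
hub. -/
lemma potential_path_succ (A : Snake n k) (x : Bool × Fin (k + 1)) :
    A.potential (A.path x.1 (x.2 + 1)) = 1 + (x.2 + 1 : ℝ) / (k + 1) := by
  have hx := x.2.is_lt
  by_cases h : (x.2 : ℕ) + 1 ≤ k
  · rw [potential_path A _ (by omega) h]; push_cast; rfl
  · have h' : (x.2 : ℕ) = k := by omega
    rw [h', path_last, potential_hub, div_self (by positivity)]
    norm_num

lemma potential_neg_path_of_lt (A : Snake n k) (x : Bool × Fin (k + 1)) :
    A.potential (A.path x.1 x.2).neg = 1 + (k + 1 - x.2 : ℝ) / (k + 1) := by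
  have hx := x.2.is_lt
  by_cases h : 1 ≤ (x.2 : ℕ)
  · exact potential_neg_path A _ h (by omega)
  · have h' : (x.2 : ℕ) = 0 := by omega
    rw [h', path_zero, Literal.neg, potential_hub, Nat.cast_zero, sub_zero,
      div_self (by positivity)]
    norm_num

lemma sum_kernel_mul (A : Snake n k) (u : Literal n) (g : Literal n → ℝ) :
    ∑ v, A.kernel u v * g v = ∑ x : Bool × Fin (k + 1),
      ((if u = A.path x.1 x.2 then g (A.path x.1 (x.2 + 1)) else 0) +
        if u = (A.path x.1 (x.2 + 1)).neg then g (A.path x.1 x.2).neg else 0) := by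
  simp_rw [kernel, Finset.sum_mul]
  rw [Finset.sum_comm]
  refine Finset.sum_congr rfl fun x _ => ?_
  simp_rw [add_mul]
  rw [Finset.sum_add_distrib]
  congr 1 <;> split_ifs <;> simp

/-- Each step adds 1/(k+1) to a summand that is at least 1, hence the rate 1 + 1/(k+1). The doubling
at the hub is paid for by the growth from 1 to 2 along a path. Each of the 2(k+1) steps contributes
at most 4 to the total. -/
lemma isPotential (A : Snake n k) :
    IsPotential A.kernel A.potential (1 + 1 / (k + 1)) (8 * (k + 1)) := by
  have hk : (0 : ℝ) < k + 1 := by positivity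
  have hx (x : Bool × Fin (k + 1)) : (0 : ℝ) ≤ k - x.2 := by
    have := x.2.is_le
    rw [sub_nonneg]
    exact_mod_cast this
  have nn1 (x : Bool × Fin (k + 1)) : 0 ≤ (x.2 : ℝ) / (k + 1) := by positivity
  have nn2 (x : Bool × Fin (k + 1)) : 0 ≤ (k - x.2 : ℝ) / (k + 1) := div_nonneg (hx x) hk.le
  have le1 (x : Bool × Fin (k + 1)) : (x.2 : ℝ) / (k + 1) ≤ 1 := by
    rw [div_le_one hk]; linarith [hx x]
  have le2 (x : Bool × Fin (k + 1)) : (k - x.2 : ℝ) / (k + 1) ≤ 1 := by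
    rw [div_le_one hk]; linarith [Nat.cast_nonneg (α := ℝ) (x.2 : ℕ)]
  have hterm (u : Literal n) (x : Bool × Fin (k + 1)) :
      0 ≤ (if u = A.path x.1 x.2 then 1 + (x.2 : ℝ) / (k + 1) else 0) +
        if u = (A.path x.1 (x.2 + 1)).neg then 1 + (k - x.2 : ℝ) / (k + 1) else 0 := by
    refine add_nonneg ?_ ?_ <;> split_ifs <;> first | exact le_rfl | linarith [nn1 x, nn2 x]
  have hex (u : Literal n) (h : A.potential u ≠ 0) : ∃ x : Bool × Fin (k + 1),
      u = A.path x.1 x.2 ∨ u = (A.path x.1 (x.2 + 1)).neg := by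
    by_contra! hcon
    exact h (Finset.sum_eq_zero fun x _ => by simp [hcon x])
  have hval (u : Literal n) (h : A.potential u ≠ 0) :
      1 ≤ A.potential u ∧ A.potential u ≤ 2 := by
    obtain ⟨x, rfl | rfl⟩ := hex u h
    · have hx2 := x.2.is_lt
      by_cases h0 : 1 ≤ (x.2 : ℕ)
      · rw [potential_path A _ h0 (by omega)]
        constructor <;> linarith [nn1 x, le1 x]
      · rw [show (x.2 : ℕ) = 0 by omega, path_zero, potential_hub]
        norm_num
    · have hx2 := x.2.is_lt
      by_cases h0 : (x.2 : ℕ) + 1 ≤ k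
      · rw [potential_neg_path A _ (by omega) h0,
          show ((k : ℝ) + 1 - ((x.2 + 1 : ℕ) : ℝ)) = k - x.2 by push_cast; ring]
        constructor <;> linarith [nn2 x, le2 x]
      · rw [show (x.2 : ℕ) = k by omega, path_last, Literal.neg, potential_hub]
        norm_num
  refine ⟨?_, ?_, ?_, ?_, ?_, ?_, ?_, ?_⟩
  · intro u v
    exact Finset.sum_nonneg fun x _ =>
      add_nonneg (by split_ifs <;> simp) (by split_ifs <;> simp)
  · exact fun u => Finset.sum_nonneg fun x _ => hterm u x
  · intro u
    by_cases h : A.potential u = 0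
    · rw [h]; norm_num
    · exact (hval u h).2
  · exact fun u h => (hval u h).1
  · simp_rw [potential]
    rw [Finset.sum_comm]
    have : ∀ x ∈ (Finset.univ : Finset (Bool × Fin (k + 1))),
        (∑ u : Literal n, ((if u = A.path x.1 x.2 then 1 + (x.2 : ℝ) / (k + 1) else 0) +
          if u = (A.path x.1 (x.2 + 1)).neg then 1 + (k - x.2 : ℝ) / (k + 1) else 0)) ≤ 4 := by
      intro x _
      rw [Finset.sum_add_distrib]
      simp only [Finset.sum_ite_eq', Finset.mem_univ, if_true]
      linarith [le1 x, le2 x]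
    refine (Finset.sum_le_card_nsmul _ _ _ this).trans (le_of_eq ?_)
    simp
    ring
  · intro u
    have := A.sum_kernel_mul u fun _ => 1
    simp only [mul_one] at this
    rw [this, potential]
    refine Finset.sum_le_sum fun x _ => add_le_add ?_ ?_ <;> split_ifs <;>
      first | exact le_rfl | linarith [nn1 x, nn2 x]
  · intro u
    rw [sum_kernel_mul, potential, Finset.mul_sum]
    refine Finset.sum_le_sum fun x _ => ?_
    rw [potential_path_succ, potential_neg_path_of_lt, mul_add]
    refine add_le_add ?_ ?_
    · split_ifs
      · have : 0 ≤ 1 / (k + 1 : ℝ) * (x.2 / (k + 1)) := mul_nonneg (by positivity) (nn1 x)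
        rw [add_div]
        linarith
      · simp
    · split_ifs
      · have : 0 ≤ 1 / (k + 1 : ℝ) * ((k - x.2) / (k + 1)) := mul_nonneg (by positivity) (nn2 x)
        rw [show (k + 1 - x.2 : ℝ) = (k - x.2) + 1 by ring, add_div]
        linarith
      · simp
  · intro u v hv
    refine Finset.sum_eq_zero fun x _ => ?_
    have h1 : v ≠ A.path x.1 (x.2 + 1) := by
      rintro rfl
      rw [potential_path_succ] at hv
      have : 0 ≤ (x.2 + 1 : ℝ) / (k + 1) := by positivity
      linarith
    have h2 : v ≠ (A.path x.1 x.2).neg := by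
      rintro rfl
      rw [potential_neg_path_of_lt, show (k + 1 - x.2 : ℝ) = (k - x.2) + 1 by ring, add_div] at hv
      have : 0 ≤ 1 / (k + 1 : ℝ) := by positivity
      linarith [nn2 x]
    simp [h1, h2]

end Snake

/-! ### Second moment of the number of snakes -/

namespace Snake
variable {n k : ℕ}

/-- A clause of `B` outside `A` costs q and a shared one costs 1. Both are at most q (1 + q⁻¹
`A.kernel`), as the kernel is at least 1 on shared clauses. -/
lemma pow_card_union_le (hk : 1 ≤ k) (A B : Snake n k) {q : ℝ} (hq : 0 < q) :
    q ^ (A.clauses ∪ B.clauses).card ≤ q ^ (4 * (k + 1)) * ∏ x : Bool × Fin (k + 1),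
      (1 + q⁻¹ * A.kernel (B.path x.1 x.2) (B.path x.1 (x.2 + 1))) := by
  have h1 : q ^ (B.clauses \ A.clauses).card ≤ q ^ (2 * (k + 1)) * ∏ x : Bool × Fin (k + 1),
      (1 + q⁻¹ * A.kernel (B.path x.1 x.2) (B.path x.1 (x.2 + 1))) := by
    have e : q ^ (B.clauses \ A.clauses).card =
        ∏ x : Bool × Fin (k + 1), if B.clause x ∈ A.clauses then 1 else q := by
      rw [← Finset.prod_image (s := Finset.univ) (g := B.clause)
        (f := fun s => if s ∈ A.clauses then 1 else q) (B.clause_injective hk).injOn,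
        Finset.prod_ite, Finset.prod_const_one, one_mul, Finset.prod_const,
        Finset.sdiff_eq_filter]
      rfl
    have e2 : q ^ (2 * (k + 1)) = ∏ _x : Bool × Fin (k + 1), q := by simp
    rw [e, e2, ← Finset.prod_mul_distrib]
    refine Finset.prod_le_prod (fun x _ => by split_ifs <;> positivity) fun x _ => ?_
    rw [mul_add, mul_one, mul_inv_cancel_left₀ hq.ne']
    split_ifs with h
    · have := A.one_le_kernel h
      linarith
    · have := A.isPotential.kernel_nonneg (B.path x.1 x.2) (B.path x.1 (x.2 + 1))
      linarith
  rw [Finset.union_comm, ← Finset.card_sdiff_add_card, pow_add, card_clauses hk,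
    show 4 * (k + 1) = 2 * (k + 1) + 2 * (k + 1) by ring, pow_add]
  have := mul_le_mul_of_nonneg_right h1 (pow_nonneg hq.le (2 * (k + 1)))
  linarith

/-- Dropping the condition that the atoms differ only adds nonnegative terms; the two arms then
become independent for a given hub. -/
lemma sum_prod_path_le (R : Literal n → Literal n → ℝ) (hR : ∀ u v, 0 ≤ R u v) :
    ∑ B : Snake n k, ∏ x : Bool × Fin (k + 1), R (B.path x.1 x.2) (B.path x.1 (x.2 + 1)) ≤
      ∑ y : Fin n, ∏ b : Bool, (kernelOp R)^[k + 1] (pointMass (y, !b)) (y, b) := by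
  have hinj : Function.Injective fun B : Snake n k => (B.hub, B.arm) := by
    intro A B h
    obtain ⟨h1, h2⟩ := Prod.mk.inj h
    have h3 := fun b j => congrFun (congrFun h2 b) j
    refine Prod.ext (DFunLike.ext _ _ ?_) (funext fun x => congrArg Prod.snd (h3 x.1 x.2))
    rintro (_ | x)
    · exact h1
    · exact congrArg Prod.fst (h3 x.1 x.2)
  let g (z : Fin n × (Bool → Fin k → Literal n)) : ℝ := ∏ b : Bool, ∏ i : Fin (k + 1),
    R (pathSeq (z.1, b) (z.2 b) (z.1, !b) i) (pathSeq (z.1, b) (z.2 b) (z.1, !b) (i + 1))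
  calc _ = ∑ B : Snake n k, g (B.hub, B.arm) := by
        refine Finset.sum_congr rfl fun B _ => ?_
        rw [Fintype.prod_prod_type]
        rfl
    _ = ∑ z ∈ Finset.univ.image fun B : Snake n k => (B.hub, B.arm), g z :=
        (Finset.sum_image hinj.injOn).symm
    _ ≤ ∑ z, g z := Finset.sum_le_sum_of_subset_of_nonneg (Finset.subset_univ _) fun z _ _ =>
        Finset.prod_nonneg fun b _ => Finset.prod_nonneg fun i _ => hR _ _
    _ = _ := by
        rw [Fintype.sum_prod_type]
        refine Finset.sum_congr rfl fun y _ => ?_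
        simp_rw [← sum_prod_pathSeq]
        rw [Finset.prod_univ_sum, Fintype.piFinset_univ]

lemma card_eq : Fintype.card (Snake n k) = n.descFactorial (2 * k + 1) * 2 ^ (2 * k) := by
  simp [Fintype.card_embedding_eq]

lemma le_card (hn : 0 < n) (hkn : 2 * k ≤ n) :
    (2 * n : ℝ) ^ (2 * k) * (n * (1 - 2 * k * (2 * k + 1) / n)) ≤ Fintype.card (Snake n k) := by
  have hn0 : (0 : ℝ) < n := by exact_mod_cast hn
  have h1 : ((n - 2 * k : ℝ)) ^ (2 * k + 1) ≤ n.descFactorial (2 * k + 1) := by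
    have := Nat.pow_sub_le_descFactorial n (2 * k + 1)
    rw [Nat.add_sub_add_right] at this
    have h2 : (((n - 2 * k) ^ (2 * k + 1) : ℕ) : ℝ) ≤ n.descFactorial (2 * k + 1) := by
      exact_mod_cast this
    push_cast [Nat.cast_sub hkn] at h2
    exact h2
  have h2 : 1 + ((2 * k + 1 : ℕ) : ℝ) * (-(2 * k / n)) ≤ (1 + -(2 * k / n : ℝ)) ^ (2 * k + 1) := by
    refine one_add_mul_le_pow ?_ _
    have : (2 * k / n : ℝ) ≤ 1 := by
      rw [div_le_one hn0]; exact_mod_cast hkn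
    linarith
  have h3 : (n - 2 * k : ℝ) ^ (2 * k + 1) = n ^ (2 * k + 1) * (1 + -(2 * k / n)) ^ (2 * k + 1) := by
    rw [← mul_pow]; congr 1; field_simp; ring
  rw [card_eq]
  push_cast at h2 ⊢
  calc _ = (n ^ (2 * k + 1) * (1 + (2 * k + 1) * (-(2 * k / n)))) * (2 : ℝ) ^ (2 * k) := by
        rw [mul_pow]; ring
    _ ≤ _ := by
        refine mul_le_mul_of_nonneg_right (le_trans ?_ h1) (by positivity)
        rw [h3]
        exact mul_le_mul_of_nonneg_left h2 (by positivity)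

lemma sum_pow_card_union_le (hk : 1 ≤ k) (hn : 0 < n) (A : Snake n k) {q β K : ℝ} (hq : 0 < q)
    (hβ : 0 ≤ β) (hqβ : q⁻¹ * (1 + 1 / (k + 1)) ≤ β * (2 * n)) (hK : 0 ≤ K)
    (hKβ : β * (1 + K) ≤ K) {G D : ℝ} (hG : G = (1 + K * (4 * (k + 1) / n)) ^ (k + 1))
    (hD : D = (1 + 8 * (k + 1) ^ 2) * G * (1 + 2 * K) + 2 * (2 * n * β ^ (k + 1))) :
    ∑ B : Snake n k, q ^ (A.clauses ∪ B.clauses).card ≤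
      q ^ (4 * (k + 1)) * ((2 * n) ^ (2 * k) * (n * G ^ 2 + 8 * (k + 1) * D ^ 2)) := by
  have hn0 : (0 : ℝ) < n := by exact_mod_cast hn
  refine (Finset.sum_le_sum fun B _ => pow_card_union_le hk A B hq).trans ?_
  rw [← Finset.mul_sum]
  refine mul_le_mul_of_nonneg_left ?_ (by positivity)
  have H := A.isPotential
  have hR : ∀ u v, 0 ≤ 1 + q⁻¹ * A.kernel u v := fun u v => by
    have := mul_nonneg (inv_nonneg.2 hq.le) (H.kernel_nonneg u v)
    linarith
  refine (sum_prod_path_le (fun u v => 1 + q⁻¹ * A.kernel u v) hR).trans ?_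
  have hr : q⁻¹ ≤ β * (2 * n) := by
    refine le_trans ?_ hqβ
    have : 0 ≤ q⁻¹ * (1 / (k + 1)) := by positivity
    linarith
  have hent := H.entry_le (L := 2 * n) (r := q⁻¹) (σ := 4 * (k + 1) / n)
    (by simp; ring) (by positivity) hβ hr hqβ hK hKβ (by positivity)
    (by field_simp; norm_num) k
  have hsq : (1 + ((k : ℝ) + 1) * (2 * n * (4 * (k + 1) / n))) = 1 + 8 * (k + 1) ^ 2 := by
    field_simp; ring
  rw [← hG, hsq, ← hD] at hent
  set W : Literal n → Literal n → ℝ := fun u v =>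
    (kernelOp fun u v => 1 + q⁻¹ * A.kernel u v)^[k + 1] (pointMass v) u with hW
  have hW0 : ∀ u v, 0 ≤ W u v := by
    intro u v
    rw [hW]
    simp only
    rw [← sum_prod_pathSeq]
    exact Finset.sum_nonneg fun f _ => Finset.prod_nonneg fun i _ => hR _ _
  have hL : (0 : ℝ) < 2 * n := by positivity
  have hG0 : 0 ≤ G := by rw [hG]; positivity
  have hterm : ∀ y : Fin n, ∏ b : Bool, W (y, b) (y, !b) ≤ (2 * n : ℝ) ^ (2 * k) *
      (G ^ 2 + D ^ 2 * (A.potential (y, true) + A.potential (y, false))) := by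
    intro y
    rw [Fintype.prod_bool]
    have ht := H.nonneg (y, true)
    have hf := H.nonneg (y, false)
    have e : ∀ Z, (2 * n : ℝ) * W (y, true) (y, false) ≤ (2 * n) ^ (k + 1) * Z →
        (2 * n : ℝ) * W (y, false) (y, true) ≤ (2 * n) ^ (k + 1) * Z →
        W (y, true) (y, false) * W (y, false) (y, true) ≤ (2 * n : ℝ) ^ (2 * k) * Z ^ 2 := by
      intro Z h1 h2
      have h3 := mul_le_mul h1 h2 (mul_nonneg hL.le (hW0 _ _))
        ((mul_nonneg hL.le (hW0 _ _)).trans h1)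
      refine le_of_mul_le_mul_left (a := (2 * n : ℝ) ^ 2) ?_ (by positivity)
      calc _ = (2 * n : ℝ) * W (y, true) (y, false) * (2 * n * W (y, false) (y, true)) := by ring
        _ ≤ _ := h3
        _ = _ := by ring
    -- Hubs of zero potential get the sharp bound `G`. The others get the crude bound `D` and are
    -- charged to the potential, whose total is only O(k).
    by_cases hp : A.potential (y, true) = 0 ∧ A.potential (y, false) = 0
    · refine (e G ((hent _ _).2 hp.1 hp.2) ((hent _ _).2 hp.2 hp.1)).trans (le_of_eq ?_)
      rw [hp.1, hp.2]; ring
    · refine (e D (hent _ _).1 (hent _ _).1).trans (mul_le_mul_of_nonneg_left ?_ (by positivity))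
      have h1 : 1 ≤ A.potential (y, true) + A.potential (y, false) := by
        rcases not_and_or.1 hp with h | h
        · linarith [H.one_le _ h]
        · linarith [H.one_le _ h]
      have := mul_le_mul_of_nonneg_left h1 (sq_nonneg D)
      have := sq_nonneg G
      linarith
  refine (Finset.sum_le_sum fun y _ => hterm y).trans ?_
  rw [← Finset.mul_sum]
  refine mul_le_mul_of_nonneg_left ?_ (by positivity)
  have hS := H.sum_le
  rw [Fintype.sum_prod_type] at hS
  simp only [Fintype.sum_bool] at hS
  rw [Finset.sum_add_distrib, ← Finset.mul_sum]
  have := mul_le_mul_of_nonneg_left hS (sq_nonneg D)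
  simp only [Finset.sum_const, Finset.card_univ, Fintype.card_fin, nsmul_eq_mul]
  linarith

end Snake

lemma randomFormula_real_satisfiable_le {c : ℝ} {m n k : ℕ} (Λ : Finset (Literal m)) (hk : 1 ≤ k)
    (hn : 0 < n) {β K : ℝ} (hq : 0 < projProb c m n Λ.card) (hβ : 0 ≤ β)
    (hqβ : (projProb c m n Λ.card)⁻¹ * (1 + 1 / (k + 1)) ≤ β * (2 * n)) (hK : 0 ≤ K)
    (hKβ : β * (1 + K) ≤ K) {G D ε : ℝ} (hG : G = (1 + K * (4 * (k + 1) / n)) ^ (k + 1))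
    (hD : D = (1 + 8 * (k + 1) ^ 2) * G * (1 + 2 * K) + 2 * (2 * n * β ^ (k + 1)))
    (hkn : 2 * k ≤ n) (hε : 0 ≤ ε) (hpos : (0 : ℝ) < 1 - 2 * k * (2 * k + 1) / n)
    (h : G ^ 2 + 8 * (k + 1) * D ^ 2 / n ≤ (1 + ε) * (1 - 2 * k * (2 * k + 1) / n)) :
    (randomFormula c m n).real {F | Satisfiable (F.proj Λ)} ≤ ε := by
  have hn0 : (0 : ℝ) < n := by exact_mod_cast hn
  set q := projProb c m n Λ.card with hqdef
  have hcard := Snake.le_card hn hkn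
  have hcard0 : (0 : ℝ) < Fintype.card (Snake n k) := lt_of_lt_of_le (by positivity) hcard
  let E (A : Snake n k) : Set (Formula m n) := {F | ∀ s ∈ A.clauses, s ∈ F.proj Λ}
  have hclauses (A : Snake n k) : ∀ s ∈ A.clauses, IsTwoClause s := by
    intro s hs
    obtain ⟨x, -, rfl⟩ := Finset.mem_image.1 hs
    exact A.isTwoClause_clause hk x
  have hE : ∀ A : Snake n k, (randomFormula c m n).real (E A) = q ^ (2 * (k + 1)) := fun A => by
    rw [← A.card_clauses hk]
    exact randomFormula_real_proj c m n Λ _ (hclauses A)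
  have hEE : ∀ A B : Snake n k, (randomFormula c m n).real (E A ∩ E B) =
      q ^ (A.clauses ∪ B.clauses).card := fun A B => by
    rw [hqdef, ← randomFormula_real_proj c m n Λ]
    · congr 1
      ext F
      simp only [E, Set.mem_inter_iff, Set.mem_ofPred_eq, Finset.mem_union]
      exact ⟨fun H s hs => hs.elim (H.1 s) (H.2 s),
        fun H => ⟨fun s hs => H s (Or.inl hs), fun s hs => H s (Or.inr hs)⟩⟩
    · intro s hs
      exact (Finset.mem_union.1 hs).elim (hclauses A s) (hclauses B s)
  have hsum : ∑ A, (randomFormula c m n).real (E A) =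
      Fintype.card (Snake n k) * q ^ (2 * (k + 1)) := by
    simp [hE]
  refine (measureReal_mono (s₂ := {F | ∀ A : Snake n k, F ∉ E A}) ?_ (measure_ne_top _ _)).trans
    (measureReal_forall_notMem_le _ E ε (by rw [hsum]; positivity) ?_)
  · intro F hF A hA
    exact A.not_satisfiable hA hF
  · simp_rw [hEE]
    refine (Finset.sum_le_sum fun A _ => Snake.sum_pow_card_union_le hk hn A hq
      hβ hqβ hK hKβ hG hD).trans ?_
    rw [hsum, Finset.sum_const, nsmul_eq_mul, Finset.card_univ]
    have h1 : (2 * n : ℝ) ^ (2 * k) * (n * G ^ 2 + 8 * (k + 1) * D ^ 2) ≤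
        (1 + ε) * Fintype.card (Snake n k) := by
      calc _ = (2 * n : ℝ) ^ (2 * k) * (n * (G ^ 2 + 8 * (k + 1) * D ^ 2 / n)) := by
            field_simp
        _ ≤ (2 * n : ℝ) ^ (2 * k) * (n * ((1 + ε) * (1 - 2 * k * (2 * k + 1) / n))) := by
            gcongr
        _ = (1 + ε) * ((2 * n : ℝ) ^ (2 * k) * (n * (1 - 2 * k * (2 * k + 1) / n))) := by ring
        _ ≤ _ := mul_le_mul_of_nonneg_left hcard (by positivity)
    calc _ = (Fintype.card (Snake n k) * q ^ (4 * (k + 1))) *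
          ((2 * n : ℝ) ^ (2 * k) * (n * G ^ 2 + 8 * (k + 1) * D ^ 2)) := by ring
      _ ≤ (Fintype.card (Snake n k) * q ^ (4 * (k + 1))) *
          ((1 + ε) * Fintype.card (Snake n k)) := mul_le_mul_of_nonneg_left h1 (by positivity)
      _ = _ := by ring

/-! ### Asymptotics and the case c > 2 -/

open Filter Topology

/-- From (1 - p)^m ≤ exp(-pm) and pm = c/(4n); the bound is uniform in `m`, and `hcn` prevents
truncation of p. -/
lemma le_projProb {c : ℝ} (hc : 0 < c) {m n : ℕ} (hm : 1 ≤ m) (hn : 1 ≤ n) (hcn : c ≤ 4 * n) :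
    c / 2 / (1 + c / (4 * n)) ≤ 2 * n * projProb c m n m := by
  have hn0 : (0 : ℝ) < n := by exact_mod_cast hn
  have hm0 : (0 : ℝ) < m := by exact_mod_cast hm
  have hm1 : (1 : ℝ) ≤ m := by exact_mod_cast hm
  have hp : (clauseProb c m n : ℝ) = c / (4 * m * n) := by
    rw [clauseProb, Set.coe_projIcc, min_eq_right, max_eq_right]
    · positivity
    · rw [div_le_one (by positivity)]
      nlinarith
  have h1 : (1 - (clauseProb c m n : ℝ)) ^ m ≤ 1 / (1 + c / (4 * n)) := by
    calc _ ≤ Real.exp (-(clauseProb c m n : ℝ)) ^ m :=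
          pow_le_pow_left₀ (by linarith [clauseProb_le_one c m n])
            (Real.one_sub_le_exp_neg _) _
      _ = (Real.exp (c / (4 * n)))⁻¹ := by
          rw [← Real.exp_nat_mul, ← Real.exp_neg, hp]
          congr 1
          field_simp
      _ ≤ (1 + c / (4 * n))⁻¹ := by
          refine inv_anti₀ (by positivity) ?_
          linarith [Real.add_one_le_exp (c / (4 * n))]
      _ = _ := (one_div _).symm
  have h2 : c / 2 / (1 + c / (4 * n)) = 2 * n * (1 - 1 / (1 + c / (4 * n))) := by
    field_simp
    ring
  rw [h2, projProb]
  gcongr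

/-- Since n is polynomial in k, n β^k tends to 0 and D = O(k^2). Since n ≥ k^8, the errors, of order
k^2/n and k^5/n, vanish. -/
lemma eventually_second_moment_bound {β K ε : ℝ} (hβ : 0 ≤ β) (hβ1 : β < 1) (hK : 0 ≤ K)
    (hε : 0 < ε) : ∀ᶠ k : ℕ in atTop, ∀ n : ℕ, k ^ 8 ≤ n → n < (k + 1) ^ 8 → ∀ G D : ℝ,
      G = (1 + K * (4 * (k + 1) / n)) ^ (k + 1) →
      D = (1 + 8 * (k + 1) ^ 2) * G * (1 + 2 * K) + 2 * (2 * n * β ^ (k + 1)) →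
      2 * k ≤ n ∧ (0 : ℝ) < 1 - 2 * k * (2 * k + 1) / n ∧
      G ^ 2 + 8 * (k + 1) * D ^ 2 / n ≤ (1 + ε) * (1 - 2 * k * (2 * k + 1) / n) := by
  -- The 33 comes from 1 + 8(k+1)^2 ≤ 33k^2; the final 1 absorbs the term with β. The threshold
  -- 1/1024 below is 1/(4 * 256), from n ≤ (2k)^8.
  set C : ℝ := 33 * Real.exp (32 * K) * (1 + 2 * K) + 1 with hC
  have hC0 : 0 ≤ C := by positivity
  have hlim : Tendsto (fun k : ℕ => (1 + ε) * (1 - 6 / (k : ℝ)) -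
      (Real.exp (32 * K / k) + 16 * C ^ 2 / k)) atTop
      (𝓝 ((1 + ε) * (1 - 0) - (Real.exp 0 + 0))) := by
    refine ((((tendsto_const_div_atTop_nhds_zero_nat 6).const_sub 1).const_mul _).sub
      (((Real.continuous_exp.tendsto 0).comp
        (tendsto_const_div_atTop_nhds_zero_nat (32 * K))).add
        (tendsto_const_div_atTop_nhds_zero_nat _)))
  have hlim2 : Tendsto (fun k : ℕ => (k : ℝ) ^ 8 * β ^ k) atTop (𝓝 0) :=
    tendsto_pow_const_mul_const_pow_of_abs_lt_one 8 (by rwa [abs_of_nonneg hβ])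
  filter_upwards [eventually_ge_atTop 7, hlim.eventually (lt_mem_nhds (by simpa using hε)),
    hlim2.eventually (gt_mem_nhds (show (0 : ℝ) < 1 / 1024 by norm_num))]
    with k hk h1 h2 n hkn hnk G D hG hD
  have hk7 : (7 : ℝ) ≤ k := by exact_mod_cast hk
  have hk0 : (0 : ℝ) < k := by linarith
  have hkn' : (k : ℝ) ^ 8 ≤ n := by exact_mod_cast hkn
  have hnk' : (n : ℝ) ≤ (k + 1) ^ 8 := by exact_mod_cast hnk.le
  have hk1 : (k : ℝ) + 1 ≤ 2 * k := by linarith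
  have hn0 : (0 : ℝ) < n := lt_of_lt_of_le (by positivity) hkn'
  have hn256 : (n : ℝ) ≤ 256 * k ^ 8 := by
    refine hnk'.trans ((pow_le_pow_left₀ (by positivity) hk1 8).trans (le_of_eq (by ring)))
  have hone : (1 : ℝ) ≤ k := by linarith
  have hsmall : ∀ j ≤ 7, (k : ℝ) ^ j / n ≤ 1 / k := by
    intro j hj
    rw [div_le_div_iff₀ hn0 hk0, one_mul, ← pow_succ]
    exact (pow_le_pow_right₀ hone (by omega)).trans hkn'
  have hδ : 2 * k * (2 * k + 1) / n ≤ 6 / (k : ℝ) := by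
    calc 2 * k * (2 * k + 1) / (n : ℝ) ≤ 6 * (k ^ 2 / n) := by
          rw [← mul_div_assoc]
          refine div_le_div_of_nonneg_right ?_ hn0.le
          nlinarith
      _ ≤ 6 * (1 / k) := by linarith [hsmall 2 (by omega)]
      _ = _ := by ring
  have hδ1 : 6 / (k : ℝ) < 1 := by rw [div_lt_one hk0]; linarith
  have hexp : K * (4 * (k + 1) / n) * (k + 1) ≤ 16 * K / k := by
    calc K * (4 * (k + 1) / n) * (k + 1) = 4 * K * (((k : ℝ) + 1) ^ 2 / n) := by ring
      _ ≤ 4 * K * ((2 * k) ^ 2 / n) := by gcongr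
      _ = 16 * K * (k ^ 2 / n) := by ring
      _ ≤ 16 * K * (1 / k) := mul_le_mul_of_nonneg_left (hsmall 2 (by omega)) (by positivity)
      _ = _ := by ring
  have hG0 : 0 ≤ G := by rw [hG]; positivity
  have hGle : G ≤ Real.exp (16 * K / k) := by
    calc G ≤ Real.exp (K * (4 * (k + 1) / n)) ^ (k + 1) := by
          rw [hG]
          refine pow_le_pow_left₀ (by positivity) ?_ _
          linarith [Real.add_one_le_exp (K * (4 * (k + 1) / n))]
      _ = Real.exp (K * (4 * (k + 1) / n) * (k + 1)) := by
          rw [← Real.exp_nat_mul]; push_cast; ring_nf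
      _ ≤ _ := Real.exp_le_exp.2 hexp
  have hG2 : G ^ 2 ≤ Real.exp (32 * K / k) := by
    refine (pow_le_pow_left₀ hG0 hGle 2).trans (le_of_eq ?_)
    rw [← Real.exp_nat_mul]; push_cast; ring_nf
  have hGc : G ≤ Real.exp (32 * K) := by
    refine hGle.trans (Real.exp_le_exp.2 ?_)
    rw [div_le_iff₀ hk0]
    nlinarith [mul_le_mul_of_nonneg_left hone hK]
  have hDle : D ≤ C * k ^ 2 := by
    have e1 : (1 + 8 * ((k : ℝ) + 1) ^ 2) ≤ 33 * k ^ 2 := by nlinarith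
    have e2 : (1 + 8 * ((k : ℝ) + 1) ^ 2) * G * (1 + 2 * K) ≤
        33 * k ^ 2 * Real.exp (32 * K) * (1 + 2 * K) := by gcongr
    have e3 : 2 * (2 * n * β ^ (k + 1)) ≤ 1 := by
      have e4 : β ^ (k + 1) ≤ β ^ k := pow_le_pow_of_le_one hβ hβ1.le k.le_succ
      calc 2 * (2 * n * β ^ (k + 1)) ≤ 2 * (2 * (256 * (k : ℝ) ^ 8) * β ^ k) := by gcongr
        _ = 1024 * ((k : ℝ) ^ 8 * β ^ k) := by ring
        _ ≤ 1 := by linarith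
    have e5 : (1 : ℝ) ≤ k ^ 2 := one_le_pow₀ hone
    rw [hD, hC]
    linarith
  have hD0 : 0 ≤ D := by rw [hD]; positivity
  have hD2 : 8 * (k + 1) * D ^ 2 / n ≤ 16 * C ^ 2 / k := by
    calc 8 * (k + 1) * D ^ 2 / n ≤ 8 * (2 * k) * (C * k ^ 2) ^ 2 / n := by gcongr
      _ = 16 * C ^ 2 * (k ^ 5 / n) := by ring
      _ ≤ 16 * C ^ 2 * (1 / k) :=
          mul_le_mul_of_nonneg_left (hsmall 5 (by omega)) (by positivity)
      _ = _ := by ring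
  refine ⟨?_, by linarith, ?_⟩
  · refine le_trans ?_ hkn
    calc 2 * k ≤ k ^ 2 := by nlinarith
      _ ≤ k ^ 8 := Nat.pow_le_pow_right (by omega) (by norm_num)
  · have : (1 + ε) * (1 - 6 / (k : ℝ)) ≤ (1 + ε) * (1 - 2 * k * (2 * k + 1) / n) :=
      mul_le_mul_of_nonneg_left (by linarith) (by positivity)
    linarith

lemma tendsto_sqrt_atTop : Tendsto Nat.sqrt atTop atTop :=
  tendsto_atTop.2 fun b => (eventually_ge_atTop (b ^ 2)).mono fun _ h => Nat.le_sqrt'.2 h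

/-- The integer part of the eighth root. -/
def eighthRoot (n : ℕ) : ℕ := Nat.sqrt (Nat.sqrt (Nat.sqrt n))

lemma eighthRoot_pow_le (n : ℕ) : eighthRoot n ^ 8 ≤ n := by
  calc eighthRoot n ^ 8 = ((eighthRoot n ^ 2) ^ 2) ^ 2 := by ring
    _ ≤ (Nat.sqrt (Nat.sqrt n) ^ 2) ^ 2 :=
        Nat.pow_le_pow_left (Nat.pow_le_pow_left (Nat.sqrt_le' _) 2) 2
    _ ≤ Nat.sqrt n ^ 2 := Nat.pow_le_pow_left (Nat.sqrt_le' _) 2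
    _ ≤ n := Nat.sqrt_le' _

lemma lt_eighthRoot_succ_pow (n : ℕ) : n < (eighthRoot n + 1) ^ 8 := by
  have h (a b : ℕ) (h : Nat.sqrt a < b) : a < b ^ 2 := Nat.sqrt_lt'.1 h
  have := h _ _ (h _ _ (h _ _ (Nat.lt_succ_self (eighthRoot n))))
  calc n < (((eighthRoot n + 1) ^ 2) ^ 2) ^ 2 := this
    _ = _ := by ring

theorem tendsto_probTrue_zero (c : ℝ) (hc : 2 < c) (m : ℕ → ℕ)
    (hm : ∀ᶠ n : ℕ in atTop, 1 ≤ m n) :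
    Tendsto (fun n : ℕ => probTrue c (m n) n) atTop (𝓝 0) := by
  have hc0 : 0 < c := by linarith
  obtain ⟨d, hd1, hdc⟩ : ∃ d : ℝ, 1 < d ∧ d < c / 2 := exists_between (by linarith)
  have hd0 : 0 < d := by linarith
  obtain ⟨β, hβd, hβ1⟩ : ∃ β : ℝ, 1 / d < β ∧ β < 1 :=
    exists_between (by rwa [div_lt_one hd0])
  have hβ0 : 0 < β := lt_trans (by positivity) hβd
  have hβ1' : 0 < 1 - β := by linarith
  -- K = β/(1 - β) is the solution of β (1 + K) = K.
  have hK : 0 ≤ β / (1 - β) := by positivity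
  have hKβ : β * (1 + β / (1 - β)) ≤ β / (1 - β) := by
    refine le_of_eq ?_
    field_simp
    ring
  have htk : Tendsto eighthRoot atTop atTop :=
    tendsto_sqrt_atTop.comp (tendsto_sqrt_atTop.comp tendsto_sqrt_atTop)
  have hlam : Tendsto (fun k : ℕ => 1 / d * (1 + 1 / ((k : ℝ) + 1))) atTop (𝓝 (1 / d)) := by
    simpa using (tendsto_one_div_add_atTop_nhds_zero_nat (𝕜 := ℝ)).const_add 1 |>.const_mul (1 / d)
  have hq : Tendsto (fun n : ℕ => c / 2 / (1 + c / (4 * (n : ℝ)))) atTop (𝓝 (c / 2)) := by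
    have h1 : Tendsto (fun n : ℕ => c / (4 * (n : ℝ))) atTop (𝓝 0) := by
      simpa [div_div] using tendsto_const_div_atTop_nhds_zero_nat (c / 4)
    have h2 := (tendsto_const_nhds (x := c / 2)).div (h1.const_add 1) (by norm_num)
    rw [add_zero, div_one] at h2
    exact h2
  refine tendsto_order.2 ⟨fun a ha => Eventually.of_forall fun n =>
    ha.trans_le measureReal_nonneg, fun a ha => ?_⟩
  filter_upwards [hm, eventually_ge_atTop 1, hq.eventually (lt_mem_nhds hdc),
    htk.eventually (hlam.eventually (gt_mem_nhds hβd)), htk.eventually_ge_atTop 1,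
    htk.eventually (eventually_second_moment_bound hβ0.le hβ1 hK (half_pos ha)),
    tendsto_natCast_atTop_atTop.eventually_ge_atTop (c / 4)]
    with n hm hn hdn hlam hk hbound hcn
  have hn0 : (0 : ℝ) < n := by exact_mod_cast hn
  have hdq := hdn.trans_le (le_projProb hc0 hm hn (by linarith))
  have hcard : (Finset.univ ×ˢ {false} : Finset (Literal (m n))).card = m n := by simp
  have hq0 : 0 < projProb c (m n) n (m n) := by
    by_contra hcon
    have := mul_nonneg (show (0 : ℝ) ≤ 2 * n by positivity) (sub_nonneg.2 (not_lt.1 hcon))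
    linarith
  obtain ⟨h1, h2, h3⟩ := hbound n (eighthRoot_pow_le n) (lt_eighthRoot_succ_pow n) _ _ rfl rfl
  have hqβ : (projProb c (m n) n (m n))⁻¹ * (1 + 1 / ((eighthRoot n : ℝ) + 1)) ≤ β * (2 * n) := by
    have h4 : (projProb c (m n) n (m n))⁻¹ ≤ 1 / d * (2 * n) := by
      rw [inv_le_iff_one_le_mul₀ hq0, mul_assoc, one_div_mul_eq_div, one_le_div hd0]
      exact hdq.le
    calc _ ≤ 1 / d * (2 * n) * (1 + 1 / ((eighthRoot n : ℝ) + 1)) := by gcongr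
      _ = 1 / d * (1 + 1 / ((eighthRoot n : ℝ) + 1)) * (2 * n) := by ring
      _ ≤ _ := by gcongr
  have := randomFormula_real_satisfiable_le (Finset.univ ×ˢ {false} : Finset (Literal (m n))) hk hn
    (by rwa [hcard]) hβ0.le (by rwa [hcard]) hK hKβ rfl rfl h1 (half_pos ha).le h2 h3
  calc probTrue c (m n) n ≤ _ := measureReal_mono (fun F hF => Formula.satisfiable_of_isTrue hF)
    _ ≤ a / 2 := this
    _ < a := half_lt_self ha

end OneTwoQCNF

theorem proposition5 (c : ℝ) (hc : 0 < c) (m : ℕ → ℕ)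
    (hm : ∀ᶠ n : ℕ in Filter.atTop, 1 ≤ m n) :
    (c < 1 →
      Filter.Tendsto (fun n : ℕ => OneTwoQCNF.probTrue c (m n) n) Filter.atTop (nhds 1)) ∧
    (2 < c →
      Filter.Tendsto (fun n : ℕ => OneTwoQCNF.probTrue c (m n) n) Filter.atTop (nhds 0)) :=
  ⟨fun h => OneTwoQCNF.tendsto_probTrue_one c hc h m hm,
    fun h => OneTwoQCNF.tendsto_probTrue_zero c h m hm⟩
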